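/- Let $0\le p<q$ be real numbers, let $f$ be holomorphic on $D(0,r)=\{|z|<r\}$ for some $r>0$, let $\varepsilon\in(0,r)$ and $k\in\mathbb{N}_0$. Let $D_{p,q}f(z)=\frac{f(pz)-f(qz)}{pz-qz}$ for $z\ne0$, $D_{p,q}f(0)=f'(0)$, and let $D_{p,q}^k$ be its $k$-th iterate. For $x>1$ put $$E_x(z)=\sum_{n\ge0}\frac{z^n}{x^{n(n-1)/2}},\qquad \Theta_x(z)=\sum_{n\in\mathbb{Z}}\frac{z^n}{x^{n(n-1)/2}},\qquad \exp_x(z)=\sum_{n\ge0}\frac{z^n}{[n]_x^!},$$ where $[n]_x^!=\prod_{j=1}^n(1+x+\dots+x^{j-1})$. For $\theta\in\mathbb{R}$ let $L_\theta=[0,\infty)e^{i\theta}$. In the formulas below the direction $\theta$ may be fixed or may depend on $\omega$; it is required that $\arg(\omega)+\theta\not\equiv\pi \pmod{2\pi}$ for all $\omega$ with $|\omega|=\varepsilon$, with at most finitely many exceptions (for a fixed $\theta$ there is exactly one). 1. Let $p=0$ and $q>1$. There are $\alpha\in\mathbb{R}$ for which some $K>0$ satisfies $|E_q(z)|\le K\exp\left(\frac{\log^2|z|}{2\log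 q}\right)|z|^\alpha$ for all $z\neq0$, and for every such $\alpha$ and every $|z|<q^{-k}\varepsilon\min\{1,q^{\frac12-\alpha}\}$, $$D_{0,q}^kf(z)=\frac{q}{2\pi i\log q}\oint_{|\omega|=\varepsilon}f(\omega)\int_{L_\theta}\zeta^k\frac{E_q(z\zeta)}{\Theta_q(q\omega\zeta)}\,d\zeta\,d\omega.$$ 2. Let $p>0$. For every $|z|<q^{-k}\varepsilon$, $$D_{p,q}^kf(z)=\frac{p^{k(k-1)/2}\,(q/p-1)}{2\pi i\log(q/p)}\oint_{|\omega|=\varepsilon}f(\omega)\int_{L_\theta}\zeta^k\frac{\exp_{q/p}(p^kz\zeta)}{\exp_{q/p}\left(\frac qp\omega\zeta\right)}\,d\zeta\,d\omega.$$ In both cases the inner integral converges absolutely for every non-exceptional $\omega$ with $|\omega|=\varepsilon$, and the outer integrand is integrable on the circle. -/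

import Mathlib

open MeasureTheory Set

noncomputable section

namespace PQ

/-- The `(p,q)`-derivative `(f(pz) - f(qz)) / (pz - qz)`. At `z = 0` the quotient is replaced by its
limit `f'(0)`, as usual, so that the operator can be iterated on functions holomorphic at `0`. -/
def pqDeriv (p q : ℝ) (f : ℂ → ℂ) (z : ℂ) : ℂ :=
  if z = 0 then deriv f 0
  else (f ((p : ℂ) * z) - f ((q : ℂ) * z)) / ((p : ℂ) * z - (q : ℂ) * z)

/-- The `q`-number `[n]_q = 1 + q + ⋯ + q ^ (n - 1)`. -/
def qNumber (q : ℝ) (n : ℕ) : ℝ := ∑ j ∈ Finset.range n, q ^ j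

/-- The `q`-factorial `[n]_q! = [1]_q [2]_q ⋯ [n]_q`. -/
def qFactorial (q : ℝ) (n : ℕ) : ℝ := ∏ j ∈ Finset.range n, qNumber q (j + 1)

/-- The `q`-exponential `exp_q(z) = ∑_{n ≥ 0} z ^ n / [n]_q!`. -/
def qExp (q : ℝ) (z : ℂ) : ℂ := ∑' n : ℕ, z ^ n / (qFactorial q n : ℂ)

/-- `E_q(z) = ∑_{n ≥ 0} z ^ n / q ^ (n (n - 1) / 2)`. -/
def qE (q : ℝ) (z : ℂ) : ℂ := ∑' n : ℕ, z ^ n / (q : ℂ) ^ (n * (n - 1) / 2)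

/-- The Jacobi Theta function `Θ_q(z) = ∑_{n ∈ ℤ} z ^ n / q ^ (n (n - 1) / 2)`. The number
`n (n - 1)` is even, so the integer division is exact. -/
def qTheta (q : ℝ) (z : ℂ) : ℂ := ∑' n : ℤ, z ^ n / (q : ℂ) ^ (n * (n - 1) / 2)

/-- `α` is a growth exponent of `E_q`: for some `K > 0`,
`|E_q(z)| ≤ K exp(log² |z| / (2 log q)) |z| ^ α` for all `z ≠ 0`. -/
def IsGrowthExponent (q α : ℝ) : Prop :=
  ∃ K : ℝ, 0 < K ∧ ∀ z : ℂ, z ≠ 0 →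
    ‖qE q z‖ ≤ K * Real.exp (Real.log ‖z‖ ^ 2 / (2 * Real.log q)) * ‖z‖ ^ α

/-- Absolute convergence of the integral of `g` along the ray `L_θ = [0, ∞) e^{iθ}`. -/
def RayIntegrable (θ : ℝ) (g : ℂ → ℂ) : Prop :=
  IntegrableOn (fun t : ℝ => g ((t : ℂ) * Complex.exp ((θ : ℂ) * Complex.I))) (Ioi (0 : ℝ))

/-- The integral of `g` along the ray `L_θ = [0, ∞) e^{iθ}`. -/
def rayIntegral (θ : ℝ) (g : ℂ → ℂ) : ℂ :=
  ∫ t in Ioi (0 : ℝ), g ((t : ℂ) * Complex.exp ((θ : ℂ) * Complex.I)) *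
    Complex.exp ((θ : ℂ) * Complex.I)

/-- `arg ω + θ ≠ ± π`, understood modulo `2π`: the ray `ω L_θ` is not the negative real axis. -/
def IsGoodDirection (ω : ℂ) (θ : ℝ) : Prop :=
  ∀ m : ℤ, Complex.arg ω + θ ≠ (2 * (m : ℝ) + 1) * Real.pi

end PQ

end

/-!
On `z ^ n` the operator `D_{p,q}` acts as multiplication by a `(p,q)`-number followed by lowering
the degree, so by Cauchy's formula `D_{p,q}^k f(z)` is the circle integral of `f(ω)` against
`∑ₙ F (n + k) / F n * z ^ n / ω ^ (n + k + 1)`, where `F` is a factorial-type sequence with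
`F (n + 1) / F n` affine in `x ^ (n + 1)`. This series is a `q`-analogue of a Borel-Laplace
transform: `F` is, up to normalization, the moment sequence of a ray integral against `1 / D`, with
`D = Θ_q` for `x = q` and `D = exp_x` for `x = q / p`, and exchanging sum and integral puts the
entire function `∑ ζ ^ n / F n` under the integral sign. The functional equation of `D` under
dilation by `x` gives the recursion of the moments. It also gives the initial moment, since
`∫₀^∞ (h(t) - h(xt)) dt / t = (h(0) - h(∞)) log x`. The exchange requires `D` to have no zeros off
the negative real axis. For `exp_x` this follows from Euler's product, and for `Θ_q` from Jacobi's
triple product.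
-/

noncomputable section

namespace PQ

open Filter Topology

section GenExp

/-- A generalized `q`-factorial: `F n = ∏_{j=1}^n (x ^ j - a) / b`. The series `E_x` has the
coefficients `1 / F n` for `(a, b) = (0, x)`, the series `exp_x` for `(a, b) = (1, x - 1)`, so that
both are covered by one computation. -/
structure IsQFactorial (x a b : ℝ) (F : ℕ → ℝ) : Prop where
  one_lt : 1 < x
  le_one : a ≤ 1
  pos : 0 < b
  map_zero : F 0 = 1
  map_succ_mul : ∀ n, F (n + 1) * b = F n * (x ^ (n + 1) - a)

/-- The exponential series `∑ z ^ n / F n` attached to a sequence of generalized factorials. -/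
def genExp (F : ℕ → ℝ) (z : ℂ) : ℂ := ∑' n : ℕ, z ^ n / (F n : ℂ)

lemma summable_of_norm_succ_le {E : Type*} [NormedAddCommGroup E] [CompleteSpace E] {u : ℕ → E}
    {ρ : ℕ → ℝ} {l : ℝ} (hl : l < 1) (hρ : Tendsto ρ atTop (𝓝 l))
    (h : ∀ n, ‖u (n + 1)‖ ≤ ρ n * ‖u n‖) : Summable u := by
  obtain ⟨r, hr, hr1⟩ := exists_between hl
  refine summable_of_ratio_norm_eventually_le hr1 ?_
  filter_upwards [hρ.eventually_le_const hr] with n hn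
  exact (h n).trans (mul_le_mul_of_nonneg_right hn (norm_nonneg _))

lemma tendsto_pow_succ_sub_atTop {x : ℝ} (hx : 1 < x) (a : ℝ) :
    Tendsto (fun n : ℕ => x ^ (n + 1) - a) atTop atTop :=
  tendsto_atTop_add_const_right _ _
    ((tendsto_pow_atTop_atTop_of_one_lt hx).comp (tendsto_add_atTop_nat 1))

namespace IsQFactorial

variable {x a b : ℝ} {F : ℕ → ℝ}

lemma pow_succ_sub_pos (hF : IsQFactorial x a b F) (n : ℕ) : 0 < x ^ (n + 1) - a :=
  sub_pos.2 (hF.le_one.trans_lt (one_lt_pow₀ hF.one_lt n.succ_ne_zero))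

lemma map_succ (hF : IsQFactorial x a b F) (n : ℕ) :
    F (n + 1) = F n * ((x ^ (n + 1) - a) / b) := by
  rw [← mul_div_assoc, ← hF.map_succ_mul, mul_div_cancel_right₀ _ hF.pos.ne']

lemma map_pos (hF : IsQFactorial x a b F) (n : ℕ) : 0 < F n := by
  induction n with
  | zero => simp [hF.map_zero]
  | succ n ih => exact hF.map_succ n ▸ mul_pos ih (div_pos (hF.pow_succ_sub_pos n) hF.pos)

lemma summable_pow_div (hF : IsQFactorial x a b F) (R : ℝ) : Summable fun n => R ^ n / F n := by
  have hρ : Tendsto (fun n : ℕ => |R| * b / (x ^ (n + 1) - a)) atTop (𝓝 0) :=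
    (tendsto_pow_succ_sub_atTop hF.one_lt a).const_div_atTop _
  refine summable_of_norm_succ_le one_pos hρ fun n => le_of_eq ?_
  have h₁ := hF.map_pos n
  have h₂ := hF.pow_succ_sub_pos n
  have h₃ := hF.pos
  simp only [norm_div, norm_pow, Real.norm_eq_abs, hF.map_succ, abs_mul, abs_div, abs_of_pos h₁,
    abs_of_pos h₂, abs_of_pos h₃, pow_succ' |R|]
  field_simp

lemma hasSum_genExp (hF : IsQFactorial x a b F) (z : ℂ) :
    HasSum (fun n => z ^ n / (F n : ℂ)) (genExp F z) := by
  refine (Summable.of_norm ((hF.summable_pow_div ‖z‖).congr fun n => ?_)).hasSum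
  rw [norm_div, norm_pow, Complex.norm_of_nonneg (hF.map_pos n).le]

lemma continuous_genExp (hF : IsQFactorial x a b F) : Continuous (genExp F) := by
  refine continuous_iff_continuousAt.2 fun z => ?_
  have hball : ContinuousOn (genExp F) (Metric.ball 0 (‖z‖ + 1)) := by
    refine continuousOn_tsum (fun n => by fun_prop) (hF.summable_pow_div (‖z‖ + 1))
      fun n w hw => ?_
    rw [norm_div, norm_pow, Complex.norm_of_nonneg (hF.map_pos n).le]
    have := (hF.map_pos n).le
    gcongr
    exact (mem_ball_zero_iff.1 hw).le
  exact hball.continuousAt (Metric.isOpen_ball.mem_nhds (by simp))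

lemma genExp_zero (hF : IsQFactorial x a b F) : genExp F 0 = 1 := by
  have := (hF.hasSum_genExp 0).unique (hasSum_single 0 fun n hn => by simp [hn])
  simpa [hF.map_zero] using this

lemma genExp_mul (hF : IsQFactorial x a b F) (z : ℂ) :
    genExp F (x * z) = (1 - a) + (a + b * z) * genExp F z := by
  have hshift : HasSum (fun n : ℕ => (x * z) ^ (n + 1) / (F (n + 1) : ℂ) -
      a * (z ^ (n + 1) / (F (n + 1) : ℂ))) (b * z * genExp F z) := by
    refine ((hF.hasSum_genExp z).mul_left (b * z)).congr_fun fun n => ?_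
    have h₁ : (F n : ℂ) ≠ 0 := by exact_mod_cast (hF.map_pos n).ne'
    have h₂ : (F (n + 1) : ℂ) ≠ 0 := by exact_mod_cast (hF.map_pos (n + 1)).ne'
    have h₃ : (F (n + 1) : ℂ) * b = F n * (x ^ (n + 1) - a) := by exact_mod_cast hF.map_succ_mul n
    field_simp
    linear_combination -z ^ (n + 1) * h₃
  have h := ((hasSum_nat_add_iff' 1).2 ((hF.hasSum_genExp (x * z)).sub
    ((hF.hasSum_genExp z).mul_left (a : ℂ)))).unique hshift
  simp only [Finset.sum_range_one, pow_zero, hF.map_zero, Complex.ofReal_one, div_one,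
    mul_one] at h
  linear_combination h

end IsQFactorial

variable {x : ℝ}

lemma isQFactorial_triangle (hx : 1 < x) :
    IsQFactorial x 0 x fun n => x ^ (n * (n - 1) / 2) where
  one_lt := hx
  le_one := zero_le_one
  pos := one_pos.trans hx
  map_zero := by simp
  map_succ_mul n := by rw [Nat.triangle_succ]; ring

lemma isQFactorial_qFactorial (hx : 1 < x) : IsQFactorial x 1 (x - 1) (qFactorial x) where
  one_lt := hx
  le_one := le_rfl
  pos := sub_pos.2 hx
  map_zero := Finset.prod_range_zero _
  map_succ_mul n := by
    rw [qFactorial, qFactorial, Finset.prod_range_succ, mul_assoc, qNumber, geom_sum_mul]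

lemma qE_eq_genExp (x : ℝ) : qE x = genExp fun n => x ^ (n * (n - 1) / 2) := by
  funext z
  simp only [qE, genExp, Complex.ofReal_pow]

lemma hasSum_qE (hx : 1 < x) (z : ℂ) :
    HasSum (fun n : ℕ => z ^ n / (x : ℂ) ^ (n * (n - 1) / 2)) (qE x z) := by
  simpa only [qE_eq_genExp, Complex.ofReal_pow] using (isQFactorial_triangle hx).hasSum_genExp z

lemma continuous_qE (hx : 1 < x) : Continuous (qE x) :=
  qE_eq_genExp x ▸ (isQFactorial_triangle hx).continuous_genExp

lemma qE_zero (hx : 1 < x) : qE x 0 = 1 := qE_eq_genExp x ▸ (isQFactorial_triangle hx).genExp_zero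

lemma qE_mul (hx : 1 < x) (z : ℂ) : qE x (x * z) = 1 + x * z * qE x z := by
  simpa [← qE_eq_genExp] using (isQFactorial_triangle hx).genExp_mul z

lemma hasSum_qExp (hx : 1 < x) (z : ℂ) :
    HasSum (fun n : ℕ => z ^ n / (qFactorial x n : ℂ)) (qExp x z) :=
  (isQFactorial_qFactorial hx).hasSum_genExp z

lemma continuous_qExp (hx : 1 < x) : Continuous (qExp x) :=
  (isQFactorial_qFactorial hx).continuous_genExp

lemma qExp_zero (hx : 1 < x) : qExp x 0 = 1 := (isQFactorial_qFactorial hx).genExp_zero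

lemma qExp_mul (hx : 1 < x) (z : ℂ) : qExp x (x * z) = (1 + (x - 1) * z) * qExp x z := by
  have h := (isQFactorial_qFactorial hx).genExp_mul z
  push_cast at h
  rwa [sub_self, zero_add] at h

end GenExp

section Theta

variable {x : ℝ} {z : ℂ}

lemma natCast_triangle (n : ℕ) : ((n * (n - 1) / 2 : ℕ) : ℤ) = (n : ℤ) * (n - 1) / 2 := by
  cases n with
  | zero => simp
  | succ n => push_cast; simp

lemma hasSum_qTheta (hx : 1 < x) (hz : z ≠ 0) :
    HasSum (fun n : ℤ => z ^ n / (x : ℂ) ^ (n * (n - 1) / 2))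
      (qE x z + (qE x (x * z)⁻¹ - 1)) := by
  have hx₀ : (x : ℂ) ≠ 0 := by exact_mod_cast (one_pos.trans hx).ne'
  refine HasSum.of_nat_of_neg_add_one ?_ ?_
  · simpa only [← natCast_triangle, zpow_natCast] using hasSum_qE hx z
  · have h := (hasSum_nat_add_iff' 1).2 (hasSum_qE hx (x * z)⁻¹)
    simp only [Finset.sum_range_one, pow_zero, zero_mul, Nat.zero_div, div_one] at h
    refine h.congr_fun fun n => ?_
    have hn : -((n : ℤ) + 1) * (-(n + 1) - 1) / 2 = ((n + 1) * (n + 1 - 1) / 2 + (n + 1) : ℕ) := by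
      rw [← Nat.triangle_succ, natCast_triangle]
      push_cast
      ring_nf
    rw [hn, zpow_natCast, zpow_neg, ← Nat.cast_succ, zpow_natCast, pow_add, inv_pow, mul_pow]
    field_simp

lemma qTheta_eq (hx : 1 < x) (hz : z ≠ 0) : qTheta x z = qE x z + (qE x (x * z)⁻¹ - 1) :=
  (hasSum_qTheta hx hz).tsum_eq

lemma qE_inv_mul (hx : 1 < x) (hz : z ≠ 0) : qE x (x * z)⁻¹ = z * (qE x z⁻¹ - 1) := by
  have hx₀ : (x : ℂ) ≠ 0 := by exact_mod_cast (one_pos.trans hx).ne'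
  have h := qE_mul hx (x * z)⁻¹
  rw [mul_inv, mul_inv_cancel_left₀ hx₀] at h
  rw [h, mul_inv]
  field_simp
  ring

lemma qTheta_mul (hx : 1 < x) (hz : z ≠ 0) : qTheta x (x * z) = x * z * qTheta x z := by
  have hx₀ : (x : ℂ) ≠ 0 := by exact_mod_cast (one_pos.trans hx).ne'
  have hxz := mul_ne_zero hx₀ hz
  rw [qTheta_eq hx hz, qTheta_eq hx hxz, qE_mul hx, qE_inv_mul hx hxz]
  ring

lemma qTheta_inv (hx : 1 < x) (hz : z ≠ 0) : qTheta x z⁻¹ = z⁻¹ * qTheta x z := by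
  rw [qTheta_eq hx hz, qTheta_eq hx (inv_ne_zero hz), qE_inv_mul hx hz,
    qE_inv_mul hx (inv_ne_zero hz), inv_inv]
  field_simp
  ring

lemma continuousOn_qTheta (hx : 1 < x) : ContinuousOn (qTheta x) {0}ᶜ := by
  have hx₀ : (x : ℂ) ≠ 0 := by exact_mod_cast (one_pos.trans hx).ne'
  have hE := continuous_qE hx
  have hinv : ContinuousOn (fun z : ℂ => qE x (x * z)⁻¹) {0}ᶜ :=
    hE.comp_continuousOn (ContinuousOn.inv₀ (by fun_prop) fun z hz => mul_ne_zero hx₀ hz)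
  exact ContinuousOn.congr (by fun_prop) fun z hz => qTheta_eq hx hz

end Theta

section TripleProduct

variable {x : ℝ} {z : ℂ}

lemma ofReal_mul_mem_slitPlane {t : ℝ} (ht : 0 < t) (hz : z ∈ Complex.slitPlane) :
    (t : ℂ) * z ∈ Complex.slitPlane := by
  rw [Complex.mem_slitPlane_iff] at hz ⊢
  simpa [ht, ht.ne'] using hz

lemma inv_mem_slitPlane (hz : z ∈ Complex.slitPlane) : z⁻¹ ∈ Complex.slitPlane := by
  have hpos := Complex.normSq_pos.2 (Complex.slitPlane_ne_zero hz)
  rw [Complex.mem_slitPlane_iff] at hz ⊢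
  rw [Complex.inv_re, Complex.inv_im]
  exact hz.imp (div_pos · hpos) fun h => div_ne_zero (neg_ne_zero.2 h) hpos.ne'

lemma one_add_ne_zero_of_mem_slitPlane (hz : z ∈ Complex.slitPlane) : 1 + z ≠ 0 := by
  intro h
  rw [Complex.mem_slitPlane_iff, eq_neg_of_add_eq_zero_right h] at hz
  norm_num at hz

/-- The dilated `q`-exponential, which is the infinite product `∏_{j ≥ 0} (1 + z / x ^ j)`. -/
def qProd (x : ℝ) (z : ℂ) : ℂ := qExp x ((x / (x - 1) : ℝ) * z)

lemma qProd_mul (hx : 1 < x) (z : ℂ) : qProd x (x * z) = (1 + x * z) * qProd x z := by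
  have hx₁ : (x : ℂ) - 1 ≠ 0 := by exact_mod_cast (sub_pos.2 hx).ne'
  rw [qProd, qProd, mul_left_comm, qExp_mul hx]
  push_cast
  field_simp

lemma qProd_eq_prod_mul (hx : 1 < x) (z : ℂ) (N : ℕ) :
    qProd x z = (∏ j ∈ Finset.range N, (1 + z / x ^ j)) * qProd x (z / x ^ N) := by
  have hx₀ : (x : ℂ) ≠ 0 := by exact_mod_cast (one_pos.trans hx).ne'
  induction N with
  | zero => simp
  | succ N ih =>
    have h : (x : ℂ) * (z / x ^ (N + 1)) = z / x ^ N := by rw [pow_succ]; field_simp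
    rw [ih, Finset.prod_range_succ, mul_assoc, ← h, qProd_mul hx, h]

lemma tendsto_qProd_div_pow (hx : 1 < x) (z : ℂ) :
    Tendsto (fun N : ℕ => qProd x (z / x ^ N)) atTop (𝓝 1) := by
  have hlim : Tendsto (fun N : ℕ => z / (x : ℂ) ^ N) atTop (𝓝 0) := by
    have hx' : ‖(x : ℂ)⁻¹‖ < 1 := by
      rw [norm_inv, Complex.norm_of_nonneg (one_pos.trans hx).le]
      exact inv_lt_one_of_one_lt₀ hx
    simpa [div_eq_mul_inv] using (tendsto_pow_atTop_nhds_zero_of_norm_lt_one hx').const_mul z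
  have hcont : Continuous (qProd x) := (continuous_qExp hx).comp (by fun_prop)
  simpa [qProd, qExp_zero hx, Function.comp_def] using (hcont.tendsto 0).comp hlim

lemma tendsto_prod_one_add_div_pow (hx : 1 < x) (z : ℂ) :
    Tendsto (fun N => ∏ j ∈ Finset.range N, (1 + z / x ^ j)) atTop (𝓝 (qProd x z)) := by
  have hlim := (tendsto_qProd_div_pow hx z).inv₀ one_ne_zero |>.const_mul (qProd x z)
  rw [inv_one, mul_one] at hlim
  refine hlim.congr' ?_
  filter_upwards [(tendsto_qProd_div_pow hx z).eventually_ne one_ne_zero] with N hN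
  rw [qProd_eq_prod_mul hx z N, mul_inv_cancel_right₀ hN]

lemma qProd_ne_zero (hx : 1 < x) (hz : z ∈ Complex.slitPlane) : qProd x z ≠ 0 := by
  obtain ⟨N, hN⟩ := ((tendsto_qProd_div_pow hx z).eventually_ne one_ne_zero).exists
  rw [qProd_eq_prod_mul hx z N]
  refine mul_ne_zero (Finset.prod_ne_zero_iff.2 fun j _ => one_add_ne_zero_of_mem_slitPlane ?_) hN
  have h := ofReal_mul_mem_slitPlane (inv_pos.2 (pow_pos (one_pos.trans hx) j)) hz
  rwa [Complex.ofReal_inv, Complex.ofReal_pow, inv_mul_eq_div] at h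

lemma qExp_ne_zero (hx : 1 < x) (hz : z ∈ Complex.slitPlane) : qExp x z ≠ 0 := by
  have hpos : 0 < x / (x - 1) := div_pos (one_pos.trans hx) (sub_pos.2 hx)
  have hne : ((x / (x - 1) : ℝ) : ℂ) ≠ 0 := by exact_mod_cast hpos.ne'
  have h := qProd_ne_zero hx (ofReal_mul_mem_slitPlane (inv_pos.2 hpos) hz)
  rwa [qProd, Complex.ofReal_inv, mul_inv_cancel_left₀ hne] at h

/-- The Euler products `∏_{j=1}^n 1 / (1 - x⁻ʲ)`, extended by `0` to negative `n`; they are the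
coefficients of `qProd x` relative to those of `E_x`. -/
def eulerCoeff (x : ℝ) : ℤ → ℝ
  | (n : ℕ) => ∏ j ∈ Finset.range n, (1 + 1 / (x ^ (j + 1) - 1))
  | .negSucc _ => 0

lemma eulerCoeff_natCast (x : ℝ) (n : ℕ) :
    eulerCoeff x n = ∏ j ∈ Finset.range n, (1 + 1 / (x ^ (j + 1) - 1)) := rfl

lemma eulerCoeff_of_neg (x : ℝ) {n : ℤ} (hn : n < 0) : eulerCoeff x n = 0 := by
  obtain ⟨m, rfl⟩ := Int.eq_negSucc_of_lt_zero hn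
  rfl

lemma exists_tendsto_eulerCoeff (hx : 1 < x) :
    ∃ a, Tendsto (fun n : ℕ => eulerCoeff x n) atTop (𝓝 a) := by
  have hx₀ := one_pos.trans hx
  have hpos (n : ℕ) : 0 < x ^ (n + 1) - 1 := sub_pos.2 (one_lt_pow₀ hx n.succ_ne_zero)
  have hsum : Summable fun n : ℕ => 1 / (x ^ (n + 1) - 1) := by
    refine summable_of_norm_succ_le (inv_lt_one_of_one_lt₀ hx) tendsto_const_nhds fun n => ?_
    rw [Real.norm_of_nonneg (one_div_pos.2 (hpos _)).le,
      Real.norm_of_nonneg (one_div_pos.2 (hpos _)).le, inv_eq_one_div, one_div_mul_one_div]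
    refine one_div_le_one_div_of_le (mul_pos hx₀ (hpos n)) ?_
    linarith [pow_succ' x (n + 1)]
  exact ⟨_, (Real.multipliable_one_add_of_summable hsum).hasProd.tendsto_prod_nat⟩

lemma eulerCoeff_mul_qFactorial (hx : 1 < x) (n : ℕ) :
    eulerCoeff x n * (qFactorial x n * (x - 1) ^ n) = x ^ (n * (n - 1) / 2 + n) := by
  induction n with
  | zero => simp [eulerCoeff, qFactorial]
  | succ n ih =>
    have hpos : 0 < x ^ (n + 1) - 1 := sub_pos.2 (one_lt_pow₀ hx n.succ_ne_zero)
    have hF := (isQFactorial_qFactorial hx).map_succ_mul n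
    have hE : eulerCoeff x (n + 1 : ℕ) * (x ^ (n + 1) - 1) = eulerCoeff x n * x ^ (n + 1) := by
      rw [eulerCoeff_natCast, Finset.prod_range_succ, ← eulerCoeff_natCast]
      field_simp
      ring
    rw [Nat.triangle_succ, pow_add _ _ (n + 1), ← ih]
    linear_combination eulerCoeff x (n + 1 : ℕ) * (x - 1) ^ n * hF + qFactorial x n *
      (x - 1) ^ n * hE

lemma hasSum_qProd (hx : 1 < x) (z : ℂ) :
    HasSum (fun n : ℕ => (eulerCoeff x n : ℂ) * (z ^ n / (x : ℂ) ^ (n * (n - 1) / 2)))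
      (qProd x z) := by
  refine (hasSum_qExp hx _).congr_fun fun n => ?_
  have hx₀ : (x : ℂ) ≠ 0 := by exact_mod_cast (one_pos.trans hx).ne'
  have hx₁ : (x : ℂ) - 1 ≠ 0 := by exact_mod_cast (sub_pos.2 hx).ne'
  have hF : (qFactorial x n : ℂ) ≠ 0 := by
    exact_mod_cast ((isQFactorial_qFactorial hx).map_pos n).ne'
  have h : (eulerCoeff x n : ℂ) * (qFactorial x n * (x - 1) ^ n) = x ^ (n * (n - 1) / 2 + n) := by
    exact_mod_cast eulerCoeff_mul_qFactorial hx n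
  rw [pow_add] at h
  push_cast
  rw [mul_pow, div_pow]
  field_simp
  linear_combination z ^ n * h

lemma triangle_sub (n N : ℤ) :
    (n - N) * (n - N - 1) / 2 + n * N = n * (n - 1) / 2 + (N * (N - 1) / 2 + N) := by
  have h (k : ℤ) : k * (k - 1) / 2 * 2 = k * (k - 1) :=
    Int.ediv_mul_cancel (Int.even_mul_pred_self k).two_dvd
  linarith [h n, h N, h (n - N)]

lemma prod_one_add_mul_qProd (hx : 1 < x) (hz : z ≠ 0) (N : ℕ) :
    x ^ (N * (N - 1) / 2 + N) * z ^ N *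
      ((∏ j ∈ Finset.range N, (1 + (x * z)⁻¹ / x ^ j)) * qProd x z) = qProd x (x ^ N * z) := by
  have hx₀ : (x : ℂ) ≠ 0 := by exact_mod_cast (one_pos.trans hx).ne'
  induction N with
  | zero => simp
  | succ N ih =>
    rw [pow_succ' (x : ℂ), mul_assoc (x : ℂ), qProd_mul hx, ← ih, Finset.prod_range_succ,
      Nat.triangle_succ]
    field_simp
    ring

lemma hasSum_prod_mul_qProd (hx : 1 < x) (hz : z ≠ 0) (N : ℕ) :
    HasSum (fun m : ℤ => (eulerCoeff x (m + N) : ℂ) * (z ^ m / (x : ℂ) ^ (m * (m - 1) / 2)))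
      ((∏ j ∈ Finset.range N, (1 + (x * z)⁻¹ / x ^ j)) * qProd x z) := by
  have hx₀ : (x : ℂ) ≠ 0 := by exact_mod_cast (one_pos.trans hx).ne'
  have hinj : Function.Injective fun n : ℕ => (n : ℤ) - N := fun m n h => by simpa using h
  have hprefactor : (x : ℂ) ^ (N * (N - 1) / 2 + N) * z ^ N ≠ 0 := by positivity
  refine (hinj.hasSum_iff fun m hm => ?_).1 ((hasSum_mul_left_iff hprefactor).1 ?_)
  · have hneg : m + N < 0 := by
      by_contra! h
      exact hm ⟨(m + N).toNat, by simp only [Int.toNat_of_nonneg h]; ring⟩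
    rw [eulerCoeff_of_neg x hneg, Complex.ofReal_zero, zero_mul]
  · rw [prod_one_add_mul_qProd hx hz]
    refine (hasSum_qProd hx _).congr_fun fun n => ?_
    have hpow : (x : ℂ) ^ (((n : ℤ) - N) * (n - N - 1) / 2) * x ^ (n * N) =
        x ^ (n * (n - 1) / 2) * x ^ (N * (N - 1) / 2 + N) := by
      have h := triangle_sub n N
      rw [← natCast_triangle, ← natCast_triangle] at h
      simp only [← zpow_natCast, ← zpow_add₀ hx₀]
      exact congrArg _ (mod_cast h)
    have hx₁ : (x : ℂ) ^ (((n : ℤ) - N) * (n - N - 1) / 2) ≠ 0 := zpow_ne_zero _ hx₀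
    simp only [Function.comp_apply, sub_add_cancel]
    rw [mul_pow, ← pow_mul, mul_comm N n, zpow_sub₀ hz, zpow_natCast, zpow_natCast]
    field_simp
    linear_combination -(eulerCoeff x n : ℂ) * hpow

theorem exists_qProd_mul_qProd_eq_qTheta (hx : 1 < x) :
    ∃ a : ℂ, ∀ z : ℂ, z ≠ 0 → qProd x (x * z)⁻¹ * qProd x z = a * qTheta x z := by
  obtain ⟨a, ha⟩ := exists_tendsto_eulerCoeff hx
  refine ⟨a, fun z hz => tendsto_nhds_unique
    ((tendsto_prod_one_add_div_pow hx (x * z)⁻¹).mul_const (qProd x z)) ?_⟩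
  obtain ⟨C, hC⟩ := ha.norm.bddAbove_range
  have hbound (n : ℤ) : ‖eulerCoeff x n‖ ≤ C := by
    rcases n with n | _
    · exact hC ⟨n, rfl⟩
    · exact (norm_zero.trans_le (norm_nonneg _)).trans (hC ⟨0, rfl⟩)
  have hlim (m : ℤ) : Tendsto (fun N : ℕ => eulerCoeff x (m + N)) atTop (𝓝 a) := by
    have hint : Tendsto (eulerCoeff x) atTop (𝓝 a) := by
      rwa [← Nat.map_cast_int_atTop, tendsto_map'_iff]
    exact hint.comp (tendsto_atTop_add_const_left _ _ tendsto_natCast_atTop_atTop)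
  simp only [← (hasSum_prod_mul_qProd hx hz _).tsum_eq, qTheta, ← tsum_mul_left]
  refine tendsto_tsum_of_dominated_convergence
    ((hasSum_qTheta hx hz).summable.norm.mul_left C)
    (fun m => ((Complex.continuous_ofReal.tendsto a).comp (hlim m)).mul_const _)
    (.of_forall fun N m => ?_)
  rw [norm_mul, Complex.norm_real]
  exact mul_le_mul_of_nonneg_right (hbound _) (norm_nonneg _)

lemma qTheta_ne_zero (hx : 1 < x) (hz : z ∈ Complex.slitPlane) : qTheta x z ≠ 0 := by
  obtain ⟨a, ha⟩ := exists_qProd_mul_qProd_eq_qTheta hx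
  have hinv := inv_mem_slitPlane (ofReal_mul_mem_slitPlane (one_pos.trans hx) hz)
  have h := mul_ne_zero (qProd_ne_zero hx hinv) (qProd_ne_zero hx hz)
  rw [ha z (Complex.slitPlane_ne_zero hz)] at h
  exact right_ne_zero_of_mul h

end TripleProduct

section Denominators

/-- A continuous zero-free function on the plane slit along `(-∞, 0]` which picks up an affine
factor under dilation by `x`; the denominators `Θ_x`, with `(a, b) = (0, x)`, and `exp_x`, with
`(a, b) = (1, x - 1)`, are of this kind. -/
structure IsDilationEquivariant (x a b : ℝ) (D : ℂ → ℂ) : Prop where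
  one_lt : 1 < x
  nonneg : 0 ≤ a
  pos : 0 < b
  continuousOn : ContinuousOn D Complex.slitPlane
  ne_zero : ∀ w ∈ Complex.slitPlane, D w ≠ 0
  map_mul : ∀ w ∈ Complex.slitPlane, D (x * w) = (a + b * w) * D w

/-- The denominators `D` for which all powers of `t` are integrable against `1 / D (t c)` on
`(0, ∞)`: growth at infinity is automatic, so only a lower bound near the origin is required. -/
structure IsRayDenominator (x a b : ℝ) (D : ℂ → ℂ) : Prop extends
    IsDilationEquivariant x a b D where
  exists_le_norm_of_le_one : ∀ c ∈ Complex.slitPlane,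
    ∃ m > 0, ∀ t : ℝ, 0 < t → t ≤ 1 → m ≤ ‖D (t * c)‖

lemma exists_pos_le_of_le_comp_mul {x T δ : ℝ} (hx : 1 < x) (hT : 0 < T) (hδ : 0 < δ) {g : ℝ → ℝ}
    (hg : ContinuousOn g (Ioi 0)) (hpos : ∀ t, 0 < t → 0 < g t)
    (hmono : ∀ t, T ≤ t → g t ≤ g (x * t)) : ∃ m > 0, ∀ t, δ ≤ t → m ≤ g t := by
  have hδT : 0 < min δ T := lt_min hδ hT
  obtain ⟨s, hs, hmin⟩ := (isCompact_Icc (a := min δ T) (b := x * T)).exists_isMinOn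
    ⟨T, min_le_right _ _, le_mul_of_one_le_left hT.le hx.le⟩
    (hg.mono fun t ht => hδT.trans_le ht.1)
  refine ⟨g s, hpos s (hδT.trans_le hs.1), fun t ht => ?_⟩
  have hiter (n : ℕ) (u : ℝ) (hu : T ≤ u) : g u ≤ g (x ^ n * u) := by
    induction n with
    | zero => simp
    | succ n ih =>
      rw [pow_succ', mul_assoc]
      exact ih.trans (hmono _ (hu.trans (le_mul_of_one_le_left (hT.le.trans hu)
        (one_le_pow₀ hx.le))))
  rcases le_total t T with htT | hTt
  · exact hmin ⟨(min_le_left _ _).trans ht, htT.trans (le_mul_of_one_le_left hT.le hx.le)⟩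
  · obtain ⟨n, hn, hn'⟩ := exists_nat_pow_near ((one_le_div hT).2 hTt) hx
    have hxn : 0 < x ^ n := pow_pos (one_pos.trans hx) n
    have hTu : T ≤ t / x ^ n := by rwa [le_div_iff₀ hxn, mul_comm, ← le_div_iff₀ hT]
    have hu : t / x ^ n ≤ x * T := by
      rw [div_le_iff₀ hxn]
      calc t ≤ x ^ (n + 1) * T := ((div_lt_iff₀ hT).1 hn').le
        _ = x * T * x ^ n := by ring
    calc g s ≤ g (t / x ^ n) := hmin ⟨(min_le_right _ _).trans hTu, hu⟩
      _ ≤ g (x ^ n * (t / x ^ n)) := hiter n _ hTu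
      _ = g t := by rw [mul_div_cancel₀ _ hxn.ne']

namespace IsDilationEquivariant

variable {x a b : ℝ} {D : ℂ → ℂ} {c : ℂ}

lemma continuousOn_ray (hD : IsDilationEquivariant x a b D) (hc : c ∈ Complex.slitPlane) :
    ContinuousOn (fun t : ℝ => D (t * c)) (Ioi 0) :=
  hD.continuousOn.comp (by fun_prop) fun _ ht => ofReal_mul_mem_slitPlane ht hc

lemma ne_zero_ray (hD : IsDilationEquivariant x a b D) (hc : c ∈ Complex.slitPlane) {t : ℝ}
    (ht : 0 < t) : D (t * c) ≠ 0 :=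
  hD.ne_zero _ (ofReal_mul_mem_slitPlane ht hc)

lemma exists_mul_pow_le_norm (hD : IsDilationEquivariant x a b D) (hc : c ∈ Complex.slitPlane)
    (N : ℕ) : ∃ m > 0, ∀ t : ℝ, 1 ≤ t → m * t ^ N ≤ ‖D (t * c)‖ := by
  have hx₀ : 0 < x := one_pos.trans hD.one_lt
  have hbc : 0 < b * ‖c‖ := mul_pos hD.pos (norm_pos_iff.2 (Complex.slitPlane_ne_zero hc))
  have hpos (t : ℝ) (ht : 0 < t) : 0 < ‖D (t * c)‖ / t ^ N :=
    div_pos (norm_pos_iff.2 (hD.ne_zero_ray hc ht)) (pow_pos ht N)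
  set T : ℝ := (x ^ N + a) / (b * ‖c‖)
  have hT : 0 < T := div_pos (add_pos_of_pos_of_nonneg (pow_pos hx₀ N) hD.nonneg) hbc
  have hmono (t : ℝ) (ht : T ≤ t) :
      ‖D (t * c)‖ / t ^ N ≤ ‖D ((x * t : ℝ) * c)‖ / (x * t) ^ N := by
    have ht₀ : 0 < t := hT.trans_le ht
    have hfactor : x ^ N ≤ ‖(a + b * (t * c) : ℂ)‖ := by
      have h := norm_sub_le (a + b * (t * c) : ℂ) a
      rw [add_sub_cancel_left, norm_mul, norm_mul, Complex.norm_of_nonneg hD.pos.le,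
        Complex.norm_of_nonneg ht₀.le, Complex.norm_of_nonneg hD.nonneg] at h
      linarith [(div_le_iff₀ hbc).1 ht]
    rw [Complex.ofReal_mul, mul_assoc, hD.map_mul _ (ofReal_mul_mem_slitPlane ht₀ hc), norm_mul,
      mul_pow, mul_div_mul_comm]
    exact le_mul_of_one_le_left (hpos t ht₀).le ((one_le_div (pow_pos hx₀ N)).2 hfactor)
  obtain ⟨m, hm, hle⟩ := exists_pos_le_of_le_comp_mul (g := fun t => ‖D (t * c)‖ / t ^ N)
    hD.one_lt hT one_pos
    ((hD.continuousOn_ray hc).norm.div (by fun_prop) fun t ht => (pow_pos ht N).ne') hpos hmono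
  refine ⟨m, hm, fun t ht => ?_⟩
  rw [← le_div_iff₀ (pow_pos (one_pos.trans_le ht) N)]
  exact hle t ht

end IsDilationEquivariant

namespace IsRayDenominator

variable {x a b : ℝ} {D : ℂ → ℂ} {c : ℂ}

lemma exists_mul_pow_le_norm (hD : IsRayDenominator x a b D) (hc : c ∈ Complex.slitPlane)
    (N : ℕ) : ∃ m > 0, ∀ t : ℝ, 0 < t → m * t ^ N ≤ ‖D (t * c)‖ := by
  obtain ⟨m₀, hm₀, h₀⟩ := hD.exists_le_norm_of_le_one c hc
  obtain ⟨m₁, hm₁, h₁⟩ := hD.toIsDilationEquivariant.exists_mul_pow_le_norm hc N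
  refine ⟨min m₀ m₁, lt_min hm₀ hm₁, fun t ht => ?_⟩
  rcases le_total t 1 with ht₁ | ht₁
  · calc min m₀ m₁ * t ^ N ≤ m₀ * 1 := by
          gcongr
          exacts [min_le_left _ _, pow_le_one₀ ht.le ht₁]
      _ ≤ ‖D (t * c)‖ := (mul_one m₀).trans_le (h₀ t ht ht₁)
  · exact (mul_le_mul_of_nonneg_right (min_le_right _ _) (pow_nonneg ht.le N)).trans (h₁ t ht₁)

lemma exists_norm_pow_div_le (hD : IsRayDenominator x a b D) (hc : c ∈ Complex.slitPlane)
    (n N : ℕ) : ∃ C, ∀ t : ℝ, 0 < t → ‖(t : ℂ) ^ n / D (t * c)‖ * t ^ N ≤ C := by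
  obtain ⟨m, hm, hle⟩ := hD.exists_mul_pow_le_norm hc (n + N)
  refine ⟨m⁻¹, fun t ht => ?_⟩
  have hpos := norm_pos_iff.2 (hD.ne_zero_ray hc ht)
  rw [norm_div, norm_pow, Complex.norm_of_nonneg ht.le, div_mul_eq_mul_div, ← pow_add,
    div_le_iff₀ hpos, ← div_eq_inv_mul, le_div_iff₀ hm, mul_comm]
  exact hle t ht

lemma integrableOn_pow_div (hD : IsRayDenominator x a b D) (hc : c ∈ Complex.slitPlane) (n : ℕ) :
    IntegrableOn (fun t : ℝ => (t : ℂ) ^ n / D (t * c)) (Ioi 0) := by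
  obtain ⟨C₀, h₀⟩ := hD.exists_norm_pow_div_le hc n 0
  obtain ⟨C₂, h₂⟩ := hD.exists_norm_pow_div_le hc n 2
  have hcont : ContinuousOn (fun t : ℝ => (t : ℂ) ^ n / D (t * c)) (Ioi 0) :=
    ContinuousOn.div (by fun_prop) (hD.continuousOn_ray hc) fun t ht => hD.ne_zero_ray hc ht
  refine (integrable_inv_one_add_sq.const_mul (C₀ + C₂)).integrableOn.mono'
    (hcont.aestronglyMeasurable measurableSet_Ioi) ?_
  refine (ae_restrict_iff' measurableSet_Ioi).2 (.of_forall fun t ht => ?_)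
  rw [← div_eq_mul_inv, le_div_iff₀ (by positivity), mul_add]
  exact add_le_add (by simpa only [pow_zero] using h₀ t ht) (h₂ t ht)

lemma tendsto_pow_div_atTop (hD : IsRayDenominator x a b D) (hc : c ∈ Complex.slitPlane) (n : ℕ) :
    Tendsto (fun t : ℝ => (t : ℂ) ^ n / D (t * c)) atTop (𝓝 0) := by
  obtain ⟨C, hC⟩ := hD.exists_norm_pow_div_le hc n 1
  refine squeeze_zero_norm' ?_ (tendsto_const_nhds (x := C) |>.div_atTop tendsto_id)
  filter_upwards [eventually_gt_atTop 0] with t ht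
  rw [id, le_div_iff₀ ht]
  simpa only [pow_one] using hC t ht

end IsRayDenominator

variable {x : ℝ}

lemma isRayDenominator_qTheta (hx : 1 < x) : IsRayDenominator x 0 x (qTheta x) := by
  have hequiv : IsDilationEquivariant x 0 x (qTheta x) :=
    { one_lt := hx
      nonneg := le_rfl
      pos := one_pos.trans hx
      continuousOn := (continuousOn_qTheta hx).mono fun w hw => Complex.slitPlane_ne_zero hw
      ne_zero := fun w hw => qTheta_ne_zero hx hw
      map_mul := fun w hw => by
        rw [qTheta_mul hx (Complex.slitPlane_ne_zero hw), Complex.ofReal_zero, zero_add] }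
  refine ⟨hequiv, fun c hc => ?_⟩
  -- `Θ(w) = w Θ(w⁻¹)` turns the growth of `Θ` at infinity into a bound at the origin.
  obtain ⟨m, hm, hle⟩ := hequiv.exists_mul_pow_le_norm (inv_mem_slitPlane hc) 1
  have hc₀ := Complex.slitPlane_ne_zero hc
  refine ⟨m * ‖c‖, mul_pos hm (norm_pos_iff.2 hc₀), fun t ht ht₁ => ?_⟩
  have htc : (t : ℂ) * c ≠ 0 := Complex.slitPlane_ne_zero (ofReal_mul_mem_slitPlane ht hc)
  have hinv := qTheta_inv hx (inv_ne_zero htc)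
  rw [inv_inv, mul_inv, ← Complex.ofReal_inv] at hinv
  rw [hinv, norm_mul, norm_mul, Complex.norm_of_nonneg ht.le]
  calc m * ‖c‖ = t * ‖c‖ * (m * t⁻¹ ^ 1) := by field_simp
    _ ≤ _ := by gcongr; exact hle _ ((one_le_inv₀ ht).2 ht₁)

lemma isRayDenominator_qExp (hx : 1 < x) : IsRayDenominator x 1 (x - 1) (qExp x) where
  one_lt := hx
  nonneg := zero_le_one
  pos := sub_pos.2 hx
  continuousOn := (continuous_qExp hx).continuousOn
  ne_zero w hw := qExp_ne_zero hx hw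
  map_mul w _ := by rw [qExp_mul hx]; push_cast; rfl
  exists_le_norm_of_le_one c hc := by
    have hcont : ContinuousOn (fun t : ℝ => ‖qExp x (t * c)‖) (Icc 0 1) :=
      ((continuous_qExp hx).comp (by fun_prop)).norm.continuousOn
    obtain ⟨s, hs, hmin⟩ := isCompact_Icc.exists_isMinOn (nonempty_Icc.2 zero_le_one) hcont
    refine ⟨‖qExp x (s * c)‖, norm_pos_iff.2 ?_, fun t ht ht₁ => hmin ⟨ht.le, ht₁⟩⟩
    rcases hs.1.eq_or_lt with rfl | hs₀
    · simp [qExp_zero hx]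
    · exact qExp_ne_zero hx (ofReal_mul_mem_slitPlane hs₀ hc)

end Denominators

section Moments

/-- The moment `∫_0^∞ t ^ n / D (t c) dt`. -/
def moment (D : ℂ → ℂ) (c : ℂ) (n : ℕ) : ℂ := ∫ t in Ioi (0 : ℝ), (t : ℂ) ^ n / D (t * c)

/-- The absolute moment `∫_0^∞ |t ^ n / D (t c)| dt`. -/
def absMoment (D : ℂ → ℂ) (c : ℂ) (n : ℕ) : ℝ := ∫ t in Ioi (0 : ℝ), ‖(t : ℂ) ^ n / D (t * c)‖

lemma absMoment_nonneg (D : ℂ → ℂ) (c : ℂ) (n : ℕ) : 0 ≤ absMoment D c n :=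
  integral_nonneg fun _ => norm_nonneg _

namespace IsRayDenominator

variable {x a b : ℝ} {D : ℂ → ℂ} {c : ℂ}

lemma pow_div_inv_mul (hD : IsRayDenominator x a b D) (hc : c ∈ Complex.slitPlane) (n : ℕ) {t : ℝ}
    (ht : 0 < t) : (x : ℂ) ^ n * (((x⁻¹ * t : ℝ) : ℂ) ^ n / D ((x⁻¹ * t : ℝ) * c)) =
      a * ((t : ℂ) ^ n / D (t * c)) + b * c / x * ((t : ℂ) ^ (n + 1) / D (t * c)) := by
  have hx₀ : 0 < x := one_pos.trans hD.one_lt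
  have hx : (x : ℂ) ≠ 0 := by exact_mod_cast hx₀.ne'
  have hu : 0 < x⁻¹ * t := mul_pos (inv_pos.2 hx₀) ht
  have hmul := hD.map_mul _ (ofReal_mul_mem_slitPlane hu hc)
  have hxu : (x : ℂ) * ((x⁻¹ * t : ℝ) * c) = t * c := by push_cast; field_simp
  have h₁ := hD.ne_zero_ray hc hu
  have h₂ : (a + b * ((x⁻¹ * t : ℝ) * c) : ℂ) ≠ 0 := by
    have h := hD.ne_zero_ray hc ht
    rw [← hxu, hmul] at h
    exact left_ne_zero_of_mul h
  rw [← hxu, hmul, ← mul_div_assoc, ← mul_div_assoc, ← mul_div_assoc, ← add_div,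
    div_eq_div_iff h₁ (mul_ne_zero h₂ h₁)]
  push_cast
  rw [mul_pow, inv_pow]
  field_simp
  ring

lemma mul_moment_succ (hD : IsRayDenominator x a b D) (hc : c ∈ Complex.slitPlane) (n : ℕ) :
    b * c * moment D c (n + 1) = x * (x ^ (n + 1) - a) * moment D c n := by
  have hx₀ : 0 < x := one_pos.trans hD.one_lt
  have hx : (x : ℂ) ≠ 0 := by exact_mod_cast hx₀.ne'
  have hdil := congrArg ((x : ℂ) ^ n * ·)
    (integral_comp_mul_left_Ioi (fun t : ℝ => (t : ℂ) ^ n / D (t * c)) 0 (inv_pos.2 hx₀))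
  simp only [mul_zero, inv_inv, ← integral_const_mul] at hdil
  rw [setIntegral_congr_fun measurableSet_Ioi fun t ht => hD.pow_div_inv_mul hc n ht,
    integral_add ((hD.integrableOn_pow_div hc n).const_mul _)
      ((hD.integrableOn_pow_div hc (n + 1)).const_mul _),
    integral_const_mul, integral_const_mul, Complex.real_smul] at hdil
  change a * moment D c n + b * c / x * moment D c (n + 1) = x ^ n * (x * moment D c n) at hdil
  field_simp at hdil
  linear_combination hdil

lemma mul_absMoment_succ_le (hD : IsRayDenominator x a b D) (hc : c ∈ Complex.slitPlane) (n : ℕ) :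
    b * ‖c‖ * absMoment D c (n + 1) ≤ x * (x ^ (n + 1) + a) * absMoment D c n := by
  have hx₀ : 0 < x := one_pos.trans hD.one_lt
  have hint (m : ℕ) := (hD.integrableOn_pow_div hc m).norm
  have hdil := integral_comp_mul_left_Ioi (fun t : ℝ => ‖(t : ℂ) ^ n / D (t * c)‖) 0
    (inv_pos.2 hx₀)
  have hdint : IntegrableOn (fun t : ℝ => ‖((x⁻¹ * t : ℝ) : ℂ) ^ n / D ((x⁻¹ * t : ℝ) * c)‖)
      (Ioi 0) := by
    rw [integrableOn_Ioi_comp_mul_left_iff (fun t : ℝ => ‖(t : ℂ) ^ n / D (t * c)‖) 0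
      (inv_pos.2 hx₀), mul_zero]
    exact hint n
  rw [mul_zero, inv_inv, smul_eq_mul] at hdil
  have hle : b * ‖c‖ / x * absMoment D c (n + 1) ≤
      x ^ n * (x * absMoment D c n) + a * absMoment D c n := by
    rw [absMoment, absMoment, ← hdil, ← integral_const_mul, ← integral_const_mul,
      ← integral_const_mul, ← integral_add (hdint.const_mul _) ((hint n).const_mul _)]
    refine setIntegral_mono_on ((hint (n + 1)).const_mul _)
      ((hdint.const_mul _).add ((hint n).const_mul _)) measurableSet_Ioi fun t ht => ?_
    have h := norm_sub_le ((x : ℂ) ^ n * (((x⁻¹ * t : ℝ) : ℂ) ^ n / D ((x⁻¹ * t : ℝ) * c)))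
      (a * ((t : ℂ) ^ n / D (t * c)))
    rw [hD.pow_div_inv_mul hc n ht, add_sub_cancel_left, ← hD.pow_div_inv_mul hc n ht] at h
    simpa only [norm_mul, norm_div, norm_pow, Complex.norm_of_nonneg hx₀.le,
      Complex.norm_of_nonneg hD.pos.le, Complex.norm_of_nonneg hD.nonneg] using h
  calc b * ‖c‖ * absMoment D c (n + 1) = x * (b * ‖c‖ / x * absMoment D c (n + 1)) := by
        field_simp
    _ ≤ x * (x ^ n * (x * absMoment D c n) + a * absMoment D c n) := by gcongr
    _ = x * (x ^ (n + 1) + a) * absMoment D c n := by ring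

lemma pow_succ_mul_moment (hD : IsRayDenominator x a b D) {F : ℕ → ℝ}
    (hF : IsQFactorial x a b F) (hc : c ∈ Complex.slitPlane) (n : ℕ) :
    c ^ (n + 1) * moment D c n = x ^ n * F n * (c * moment D c 0) := by
  induction n with
  | zero => simp [hF.map_zero]
  | succ n ih =>
    have hb : (b : ℂ) ≠ 0 := by exact_mod_cast hD.pos.ne'
    have hsucc : (F (n + 1) : ℂ) * b = F n * (x ^ (n + 1) - a) := by
      exact_mod_cast hF.map_succ_mul n
    refine mul_left_cancel₀ hb ?_
    linear_combination c ^ (n + 1) * hD.mul_moment_succ hc n + x * (x ^ (n + 1) - a) * ih -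
      x ^ (n + 1) * (c * moment D c 0) * hsucc

end IsRayDenominator

variable {x : ℝ} {c : ℂ}

lemma tendsto_ofReal_mul_nhdsGT_zero (c : ℂ) :
    Tendsto (fun t : ℝ => (t : ℂ) * c) (𝓝[>] 0) (𝓝 0) := by
  have h : Continuous fun t : ℝ => (t : ℂ) * c := by fun_prop
  simpa using (h.tendsto 0).mono_left nhdsWithin_le_nhds

lemma mul_integral_ray_of_sub_comp_mul {φ h : ℂ → ℂ} {L R : ℂ} (hx : 0 < x)
    (hc : c ∈ Complex.slitPlane) (hφ : ContinuousOn φ Complex.slitPlane)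
    (hsub : ∀ w ∈ Complex.slitPlane, φ w - φ (x * w) = w * h w)
    (hL : Tendsto (fun t : ℝ => φ (t * c)) (𝓝[>] 0) (𝓝 L))
    (hR : Tendsto (fun t : ℝ => φ (t * c)) atTop (𝓝 R))
    (hh : IntegrableOn (fun t : ℝ => h (t * c)) (Ioi 0)) :
    c * ∫ t in Ioi (0 : ℝ), h (t * c) = Real.log x * (L - R) := by
  have hray : ContinuousOn (fun t : ℝ => φ (t * c)) (Ioi 0) :=
    hφ.comp (by fun_prop) fun t ht => ofReal_mul_mem_slitPlane ht hc
  have hdiff : EqOn (fun t : ℝ => c * h (t * c))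
      (fun t : ℝ => t⁻¹ • (φ ((1 * t : ℝ) * c) - φ ((x * t : ℝ) * c))) (Ioi 0) := fun t ht => by
    have ht₀ : (t : ℂ) ≠ 0 := by exact_mod_cast (mem_Ioi.1 ht).ne'
    simp only [one_mul]
    rw [Complex.ofReal_mul, mul_assoc (x : ℂ), hsub _ (ofReal_mul_mem_slitPlane ht hc),
      Complex.real_smul, Complex.ofReal_inv, mul_assoc, inv_mul_cancel_left₀ ht₀]
  have hint : IntegrableOn (fun t : ℝ => c * h (t * c)) (Ioi 0) := hh.const_mul c
  rw [← integral_const_mul, setIntegral_congr_fun measurableSet_Ioi hdiff,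
    Frullani.integral_Ioi_eq (hray.locallyIntegrableOn measurableSet_Ioi) one_pos hx hL hR
      (hint.congr_fun hdiff measurableSet_Ioi), div_one, Complex.real_smul]

lemma inv_qExp_sub_inv_qExp_mul (hx : 1 < x) {w : ℂ} (hw : w ∈ Complex.slitPlane) :
    (qExp x ((x⁻¹ : ℝ) * w))⁻¹ - (qExp x ((x⁻¹ : ℝ) * (x * w)))⁻¹ =
      w * (((x - 1 : ℝ) / x) * (1 / qExp x w)) := by
  have hx₀ : 0 < x := one_pos.trans hx
  have hxC : (x : ℂ) ≠ 0 := by exact_mod_cast hx₀.ne'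
  have hw' : ((x⁻¹ : ℝ) : ℂ) * w ∈ Complex.slitPlane :=
    ofReal_mul_mem_slitPlane (inv_pos.2 hx₀) hw
  have hxw : (x : ℂ) * ((x⁻¹ : ℝ) * w) = w := by
    rw [Complex.ofReal_inv, mul_inv_cancel_left₀ hxC]
  have hmul := (isRayDenominator_qExp hx).map_mul _ hw'
  have hne := qExp_ne_zero hx hw
  have hne' := qExp_ne_zero hx hw'
  rw [mul_left_comm, hxw]
  rw [hxw] at hmul
  rw [inv_sub_inv hne' hne, div_eq_iff (mul_ne_zero hne' hne)]
  field_simp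
  rw [hmul]
  push_cast
  field_simp
  ring

lemma mul_moment_zero_qExp (hx : 1 < x) (hc : c ∈ Complex.slitPlane) :
    c * moment (qExp x) c 0 = x * Real.log x / (x - 1 : ℝ) := by
  have hx₀ : 0 < x := one_pos.trans hx
  have hxC : (x : ℂ) ≠ 0 := by exact_mod_cast hx₀.ne'
  have hx₁ : ((x - 1 : ℝ) : ℂ) ≠ 0 := by exact_mod_cast (sub_pos.2 hx).ne'
  have hD := isRayDenominator_qExp hx
  have hdil {w : ℂ} (hw : w ∈ Complex.slitPlane) : ((x⁻¹ : ℝ) : ℂ) * w ∈ Complex.slitPlane :=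
    ofReal_mul_mem_slitPlane (inv_pos.2 hx₀) hw
  -- `φ(w) = 1 / exp_x(w / x)` solves `φ(w) - φ(x w) = w h(w)` with `h = (x - 1) / (x exp_x)`.
  have hφ : ContinuousOn (fun w => (qExp x ((x⁻¹ : ℝ) * w))⁻¹) Complex.slitPlane :=
    ((continuous_qExp hx).comp (by fun_prop)).continuousOn.inv₀ fun w hw =>
      qExp_ne_zero hx (hdil hw)
  have hL : Tendsto (fun t : ℝ => (qExp x ((x⁻¹ : ℝ) * (t * c)))⁻¹) (𝓝[>] 0) (𝓝 1) := by
    have h := ((continuous_qExp hx).tendsto 0).comp (tendsto_ofReal_mul_nhdsGT_zero ((x⁻¹ : ℝ) * c))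
    rw [qExp_zero hx] at h
    simpa only [mul_left_comm, inv_one, Function.comp_def] using h.inv₀ one_ne_zero
  have hR : Tendsto (fun t : ℝ => (qExp x ((x⁻¹ : ℝ) * (t * c)))⁻¹) atTop (𝓝 0) := by
    simpa only [pow_zero, one_div, mul_left_comm] using hD.tendsto_pow_div_atTop (hdil hc) 0
  have hint : IntegrableOn (fun t : ℝ => ((x - 1 : ℝ) / x : ℂ) * (1 / qExp x (t * c))) (Ioi 0) := by
    simpa only [pow_zero, IntegrableOn] using
      (hD.integrableOn_pow_div hc 0).const_mul ((x - 1 : ℝ) / x : ℂ)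
  have h := mul_integral_ray_of_sub_comp_mul hx₀ hc hφ
    (fun w hw => inv_qExp_sub_inv_qExp_mul hx hw) hL hR hint
  simp only [integral_const_mul, sub_zero, mul_one] at h
  simp only [moment, pow_zero]
  rw [← h]
  field_simp

lemma tendsto_qE_div_qTheta_atTop (hx : 1 < x) (hc : c ∈ Complex.slitPlane) :
    Tendsto (fun t : ℝ => (1 + t * c - qE x (t * c)) / qTheta x (t * c)) atTop (𝓝 (-1)) := by
  have hD := isRayDenominator_qTheta hx
  have hinv : Tendsto (fun t : ℝ => qE x (x * (t * c))⁻¹) atTop (𝓝 1) := by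
    have h := (Complex.continuous_ofReal.tendsto 0).comp tendsto_inv_atTop_zero
    have h' := ((continuous_qE hx).tendsto _).comp (h.mul_const (x * c)⁻¹)
    simpa [Function.comp_def, qE_zero hx, mul_inv, mul_comm, mul_left_comm, mul_assoc] using h'
  have h := (((hD.tendsto_pow_div_atTop hc 1).const_mul c).add
    (hinv.mul (hD.tendsto_pow_div_atTop hc 0))).sub_const 1
  rw [mul_zero, one_mul, add_zero, zero_sub] at h
  refine h.congr' ?_
  filter_upwards [eventually_gt_atTop 0] with t ht
  have hne := hD.ne_zero_ray hc ht
  have hdecomp := qTheta_eq hx (Complex.slitPlane_ne_zero (ofReal_mul_mem_slitPlane ht hc))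
  rw [eq_div_iff hne, sub_mul, add_mul, mul_assoc c, mul_assoc, div_mul_cancel₀ _ hne,
    div_mul_cancel₀ _ hne]
  linear_combination -hdecomp

lemma mul_moment_zero_qTheta (hx : 1 < x) (hc : c ∈ Complex.slitPlane) :
    c * moment (qTheta x) c 0 = Real.log x := by
  have hx₀ : 0 < x := one_pos.trans hx
  have hxC : (x : ℂ) ≠ 0 := by exact_mod_cast hx₀.ne'
  have hD := isRayDenominator_qTheta hx
  -- `φ(w) = (1 + w - E_x(w)) / Θ_x(w)` satisfies `φ(x w) = (1 - E_x(w)) / Θ_x(w)`.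
  have hφ : ContinuousOn (fun w => (1 + w - qE x w) / qTheta x w) Complex.slitPlane :=
    (by have := continuous_qE hx; fun_prop : Continuous fun w => 1 + w - qE x w).continuousOn.div
      hD.continuousOn hD.ne_zero
  have hsub : ∀ w ∈ Complex.slitPlane, (1 + w - qE x w) / qTheta x w -
      (1 + x * w - qE x (x * w)) / qTheta x (x * w) = w * (1 / qTheta x w) := fun w hw => by
    have hw₀ := Complex.slitPlane_ne_zero hw
    have hne := qTheta_ne_zero hx hw
    rw [qE_mul hx, qTheta_mul hx hw₀]
    field_simp
    ring
  have hL : Tendsto (fun t : ℝ => (1 + t * c - qE x (t * c)) / qTheta x (t * c)) (𝓝[>] 0)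
      (𝓝 0) := by
    obtain ⟨C, hC⟩ := hD.exists_norm_pow_div_le hc 0 0
    have hnum : Tendsto (fun t : ℝ => 1 + t * c - qE x (t * c)) (𝓝[>] 0) (𝓝 0) := by
      have h := tendsto_ofReal_mul_nhdsGT_zero c
      simpa [qE_zero hx] using (h.const_add 1).sub (((continuous_qE hx).tendsto 0).comp h)
    simp only [div_eq_mul_inv]
    refine hnum.zero_mul_isBoundedUnder_le (isBoundedUnder_of_eventually_le (a := C) ?_)
    filter_upwards [self_mem_nhdsWithin] with t ht
    simpa using hC t ht
  have hint : IntegrableOn (fun t : ℝ => 1 / qTheta x (t * c)) (Ioi 0) := by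
    simpa only [pow_zero] using hD.integrableOn_pow_div hc 0
  have h := mul_integral_ray_of_sub_comp_mul (h := fun w => 1 / qTheta x w) hx₀ hc hφ hsub hL
    (tendsto_qE_div_qTheta_atTop hx hc) hint
  simpa only [moment, pow_zero, sub_neg_eq_add, zero_add, mul_one] using h

end Moments

section Kernel

lemma integrable_of_hasSum_of_summable_integral_norm {α ι E : Type*} [MeasurableSpace α]
    [Countable ι] [NormedAddCommGroup E] {μ : Measure α} {u : ι → α → E} {g : α → E}
    (hu : ∀ i, Integrable (u i) μ) (hsum : Summable fun i => ∫ a, ‖u i a‖ ∂μ)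
    (hg : ∀ᵐ a ∂μ, HasSum (fun i => u i a) (g a)) : Integrable g μ := by
  have hmeas : AEStronglyMeasurable g μ :=
    aestronglyMeasurable_of_tendsto_ae atTop
      (fun s => (integrable_finsetSum s fun i _ => hu i).aestronglyMeasurable) hg
  have hle : ∀ᵐ a ∂μ, ‖g a‖ₑ ≤ ∑' i, ‖u i a‖ₑ := by
    filter_upwards [hg] with a ha
    exact le_of_tendsto (Tendsto.enorm ha)
      (.of_forall fun s => (enorm_sum_le _ _).trans (ENNReal.sum_le_tsum s))
  refine ⟨hmeas, (lintegral_mono_ae hle).trans_lt ?_⟩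
  rw [lintegral_tsum fun i => (hu i).1.enorm]
  simp_rw [← ofReal_integral_norm_eq_lintegral_enorm (hu _)]
  exact hsum.tsum_ofReal_lt_top

/-- The kernel `ζ ^ k N(z ζ) / D(x ω ζ)` of the integral formula, with `N(z) = ∑ z ^ n / F n`. -/
def qKernel (F : ℕ → ℝ) (D : ℂ → ℂ) (x : ℝ) (k : ℕ) (z ω ζ : ℂ) : ℂ :=
  ζ ^ k * (genExp F (z * ζ) / D (x * ω * ζ))

lemma qKernel_mul (F : ℕ → ℝ) (D : ℂ → ℂ) (x : ℝ) (k : ℕ) (z ω t d : ℂ) :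
    qKernel F D x k z ω (t * d) =
      d ^ k * (t ^ k * (genExp F (z * d * t) / D (t * (x * (ω * d))))) := by
  rw [qKernel, mul_pow, mul_left_comm z, mul_comm t (z * d), mul_left_comm _ t d,
    mul_assoc (x : ℂ)]
  ring

namespace IsRayDenominator

variable {x a b : ℝ} {D : ℂ → ℂ} {F : ℕ → ℝ} {z c ω : ℂ} {k : ℕ}

lemma summable_pow_div_mul_absMoment (hD : IsRayDenominator x a b D) (hF : IsQFactorial x a b F)
    (hc : c ∈ Complex.slitPlane) {R : ℝ} (hR : 0 ≤ R) (hRc : x ^ (k + 1) * R < ‖c‖) :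
    Summable fun m => R ^ m / F m * absMoment D c (m + k) := by
  have hc₀ : 0 < ‖c‖ := norm_pos_iff.2 (Complex.slitPlane_ne_zero hc)
  have hnonneg (m : ℕ) : 0 ≤ R ^ m / F m * absMoment D c (m + k) :=
    mul_nonneg (div_nonneg (pow_nonneg hR m) (hF.map_pos m).le) (absMoment_nonneg _ _ _)
  have hρ : Tendsto (fun m : ℕ => x * R / ‖c‖ * (x ^ k + (a * x ^ k + a) / (x ^ (m + 1) - a)))
      atTop (𝓝 (x * R / ‖c‖ * (x ^ k + 0))) :=
    (((tendsto_pow_succ_sub_atTop hF.one_lt a).const_div_atTop _).const_add _).const_mul _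
  refine summable_of_norm_succ_le ?_ hρ fun m => ?_
  · rw [add_zero, div_mul_eq_mul_div, div_lt_one hc₀]
    exact lt_of_eq_of_lt (by ring) hRc
  have hFm := hF.map_pos m
  have hsub := hF.pow_succ_sub_pos m
  have hb := hF.pos
  have hle : absMoment D c (m + k + 1) ≤
      x * (x ^ (m + k + 1) + a) * absMoment D c (m + k) / (b * ‖c‖) := by
    rw [le_div_iff₀ (mul_pos hb hc₀), mul_comm]
    exact hD.mul_absMoment_succ_le hc (m + k)
  rw [Real.norm_of_nonneg (hnonneg _), Real.norm_of_nonneg (hnonneg _), hF.map_succ,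
    add_right_comm]
  calc R ^ (m + 1) / (F m * ((x ^ (m + 1) - a) / b)) * absMoment D c (m + k + 1)
      ≤ R ^ (m + 1) / (F m * ((x ^ (m + 1) - a) / b)) *
        (x * (x ^ (m + k + 1) + a) * absMoment D c (m + k) / (b * ‖c‖)) := by gcongr
    _ = _ := by field_simp; ring

lemma hasSum_integral_pow_mul_genExp_div (hD : IsRayDenominator x a b D)
    (hF : IsQFactorial x a b F) (hc : c ∈ Complex.slitPlane) (hz : x ^ (k + 1) * ‖z‖ < ‖c‖) :
    IntegrableOn (fun t : ℝ => (t : ℂ) ^ k * (genExp F (z * t) / D (t * c))) (Ioi 0) ∧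
      HasSum (fun m => z ^ m / F m * moment D c (m + k))
        (∫ t in Ioi (0 : ℝ), (t : ℂ) ^ k * (genExp F (z * t) / D (t * c))) := by
  have hint (m : ℕ) : Integrable (fun t : ℝ => z ^ m / F m * ((t : ℂ) ^ (m + k) / D (t * c)))
      (volume.restrict (Ioi 0)) := (hD.integrableOn_pow_div hc (m + k)).const_mul _
  have hsum : Summable fun m =>
      ∫ t in Ioi (0 : ℝ), ‖z ^ m / F m * ((t : ℂ) ^ (m + k) / D (t * c))‖ := by
    refine (hD.summable_pow_div_mul_absMoment hF hc (norm_nonneg z) hz).congr fun m => ?_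
    simp only [norm_mul (z ^ m / _), integral_const_mul]
    rw [norm_div, norm_pow, Complex.norm_of_nonneg (hF.map_pos m).le, absMoment]
  have hterm (t : ℝ) : HasSum (fun m => z ^ m / F m * ((t : ℂ) ^ (m + k) / D (t * c)))
      ((t : ℂ) ^ k * (genExp F (z * t) / D (t * c))) := by
    refine (((hF.hasSum_genExp (z * t)).div_const (D (t * c))).mul_left ((t : ℂ) ^ k)).congr_fun
      fun m => ?_
    rw [mul_pow, pow_add]
    ring
  refine ⟨integrable_of_hasSum_of_summable_integral_norm hint hsum (.of_forall hterm), ?_⟩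
  have h := hasSum_integral_of_summable_integral_norm hint hsum
  simpa only [integral_const_mul, (hterm _).tsum_eq, moment] using h

lemma rayIntegral_qKernel (hD : IsRayDenominator x a b D) (hF : IsQFactorial x a b F) {θ : ℝ}
    (hc : ω * Complex.exp (θ * Complex.I) ∈ Complex.slitPlane) (hz : x ^ k * ‖z‖ < ‖ω‖)
    (hmom : ∀ c ∈ Complex.slitPlane, c * moment D c 0 = x * Real.log x / b) :
    RayIntegrable θ (qKernel F D x k z ω) ∧
      HasSum (fun m => Real.log x / b * (F (m + k) / F m * z ^ m) * (ω ^ (m + k + 1))⁻¹)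
        (rayIntegral θ (qKernel F D x k z ω)) := by
  have hx₀ : 0 < x := one_pos.trans hF.one_lt
  have hxC : (x : ℂ) ≠ 0 := by exact_mod_cast hx₀.ne'
  set d := Complex.exp (θ * Complex.I) with hd
  have hd₀ : d ≠ 0 := Complex.exp_ne_zero _
  have hd₁ : ‖d‖ = 1 := Complex.norm_exp_ofReal_mul_I θ
  have hω : ω ≠ 0 := left_ne_zero_of_mul (Complex.slitPlane_ne_zero hc)
  have hxc := ofReal_mul_mem_slitPlane hx₀ hc
  have hzd : x ^ (k + 1) * ‖z * d‖ < ‖(x : ℂ) * (ω * d)‖ := by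
    rw [norm_mul, norm_mul, norm_mul, hd₁, mul_one, mul_one, Complex.norm_of_nonneg hx₀.le,
      pow_succ', mul_assoc]
    exact mul_lt_mul_of_pos_left hz hx₀
  obtain ⟨hint, hsum⟩ := hD.hasSum_integral_pow_mul_genExp_div hF hxc hzd
  refine ⟨?_, ?_⟩
  · simp only [RayIntegrable, ← hd, qKernel_mul]
    exact hint.const_mul _
  · simp only [rayIntegral, ← hd, qKernel_mul, integral_mul_const, integral_const_mul]
    refine ((hsum.mul_left (d ^ k)).mul_right d).congr_fun fun m => ?_
    have h := hD.pow_succ_mul_moment hF hxc (m + k)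
    rw [hmom _ hxc, mul_comm,
      ← eq_div_iff (pow_ne_zero _ (Complex.slitPlane_ne_zero hxc))] at h
    rw [h]
    have hb : (b : ℂ) ≠ 0 := by exact_mod_cast hF.pos.ne'
    simp only [mul_pow]
    field_simp
    ring

end IsRayDenominator

end Kernel

section CircleRayIntegral

/-- The formula `v = κ ∮_{|ω| = ε} f(ω) ∫_{L_{θ(ω)}} K(ω, ζ) dζ dω`, including the absolute
convergence of the inner integral in every good direction and the integrability of the outer
integrand. -/
def IsCircleRayIntegral (f : ℂ → ℂ) (ε : ℝ) (θ : ℂ → ℝ) (K : ℂ → ℂ → ℂ) (κ v : ℂ) : Prop :=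
  (∀ ω : ℂ, ‖ω‖ = ε → IsGoodDirection ω (θ ω) → RayIntegrable (θ ω) (K ω)) ∧
    CircleIntegrable (fun ω => f ω * rayIntegral (θ ω) (K ω)) 0 ε ∧
      v = κ * ∮ ω in C(0, ε), f ω * rayIntegral (θ ω) (K ω)

lemma IsCircleRayIntegral.const_mul {f : ℂ → ℂ} {ε : ℝ} {θ : ℂ → ℝ} {K : ℂ → ℂ → ℂ} {κ v : ℂ}
    (h : IsCircleRayIntegral f ε θ K κ v) (c : ℂ) :
    IsCircleRayIntegral f ε θ K (c * κ) (c * v) :=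
  ⟨h.1, h.2.1, by rw [h.2.2, mul_assoc]⟩

lemma hasSum_circleIntegral_of_summable_norm {ι E : Type*} [Countable ι] [NormedAddCommGroup E]
    [NormedSpace ℂ E] [CompleteSpace E] {u : ι → ℂ → E} {M : ι → ℝ} {c : ℂ} {R : ℝ} (hR : 0 ≤ R)
    (hM : Summable M) (hu : ∀ i, ContinuousOn (u i) (Metric.sphere c R))
    (hle : ∀ i, ∀ ω ∈ Metric.sphere c R, ‖u i ω‖ ≤ M i) :
    CircleIntegrable (fun ω => ∑' i, u i ω) c R ∧
      HasSum (fun i => ∮ ω in C(c, R), u i ω) (∮ ω in C(c, R), ∑' i, u i ω) := by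
  refine ⟨(continuousOn_tsum hu hM hle).circleIntegrable hR, ?_⟩
  have h := (tendstoUniformlyOn_tsum hM hle).tendsto_circleIntegral_of_continuousOn hR
    (.of_forall fun s => continuousOn_finsetSum s fun i _ => hu i)
  exact h.congr fun s => circleIntegral.integral_fun_sum fun i _ => (hu i).circleIntegrable hR

lemma circleIntegral_congr_ae {E : Type*} [NormedAddCommGroup E] [NormedSpace ℂ E] {g h : ℂ → E}
    {c : ℂ} {R : ℝ} (hgh : ∀ᵐ t : ℝ, g (circleMap c R t) = h (circleMap c R t)) :
    ∮ ω in C(c, R), g ω = ∮ ω in C(c, R), h ω :=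
  intervalIntegral.integral_congr_ae (hgh.mono fun t ht _ => by beta_reduce; rw [ht])

lemma IsGoodDirection.mul_exp_mem_slitPlane {ω : ℂ} {θ : ℝ} (h : IsGoodDirection ω θ)
    (hω : ω ≠ 0) : ω * Complex.exp (θ * Complex.I) ∈ Complex.slitPlane := by
  have hpolar : ω * Complex.exp (θ * Complex.I) =
      ‖ω‖ * Complex.exp ((Complex.arg ω + θ : ℝ) * Complex.I) := by
    conv_lhs => rw [← Complex.norm_mul_exp_arg_mul_I ω]
    rw [mul_assoc, ← Complex.exp_add, ← add_mul, Complex.ofReal_add]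
  rw [hpolar]
  refine ofReal_mul_mem_slitPlane (norm_pos_iff.2 hω) ?_
  rw [Complex.mem_slitPlane_iff, Complex.exp_ofReal_mul_I_re, Complex.exp_ofReal_mul_I_im]
  by_contra! hcon
  obtain ⟨hcos, hsin⟩ := hcon
  obtain ⟨n, hn⟩ := Real.sin_eq_zero_iff.1 hsin
  rcases Int.even_or_odd' n with ⟨m, rfl | rfl⟩
  · have hone : Real.cos (((2 * m : ℤ) : ℝ) * Real.pi) = 1 := by
      rw [← Real.cos_int_mul_two_pi m]
      push_cast
      ring_nf
    rw [← hn, hone] at hcos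
    exact absurd hcos one_pos.not_ge
  · exact h m (by rw [← hn]; push_cast; ring)

variable {x a b ε : ℝ} {D : ℂ → ℂ} {F : ℕ → ℝ} {f : ℂ → ℂ} {θ : ℂ → ℝ} {z : ℂ} {k : ℕ}

lemma cauchyPowerSeries_coeff (f : ℂ → ℂ) (ε : ℝ) (n : ℕ) :
    (cauchyPowerSeries f 0 ε).coeff n =
      (2 * Real.pi * Complex.I)⁻¹ * ∮ ω in C(0, ε), f ω * (ω ^ (n + 1))⁻¹ := by
  have h := cauchyPowerSeries_apply f 0 ε n 1
  rw [FormalMultilinearSeries.apply_eq_pow_smul_coeff, one_pow, one_smul] at h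
  rw [h, smul_eq_mul]
  congr 2
  funext ω
  simp only [sub_zero, smul_eq_mul, pow_succ, mul_inv, one_div]
  ring

theorem isCircleRayIntegral_of_hasSum {K : ℂ → ℂ → ℂ} {κ v : ℂ} {a : ℕ → ℂ} {N : ℕ → ℕ}
    (hε : 0 < ε) (hf : ContinuousOn f (Metric.sphere 0 ε))
    (hθ : ∀ᵐ t : ℝ, IsGoodDirection (circleMap 0 ε t) (θ (circleMap 0 ε t)))
    (hK : ∀ ω : ℂ, ‖ω‖ = ε → IsGoodDirection ω (θ ω) → RayIntegrable (θ ω) (K ω) ∧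
      HasSum (fun n => a n * (ω ^ N n)⁻¹) (rayIntegral (θ ω) (K ω)))
    (ha : Summable fun n => ‖a n * ((ε : ℂ) ^ N n)⁻¹‖)
    (hv : HasSum (fun n => κ * (a n * ∮ ω in C(0, ε), f ω * (ω ^ N n)⁻¹)) v) :
    IsCircleRayIntegral f ε θ K κ v := by
  obtain ⟨C, hC⟩ := (isCompact_sphere (0 : ℂ) ε).exists_bound_of_continuousOn hf
  have hcont (n : ℕ) : ContinuousOn (fun ω => f ω * (a n * (ω ^ N n)⁻¹)) (Metric.sphere 0 ε) :=
    hf.mul (continuousOn_const.mul (ContinuousOn.inv₀ (by fun_prop) fun ω hω =>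
      pow_ne_zero _ (Metric.ne_of_mem_sphere hω hε.ne')))
  have hle (n : ℕ) (ω : ℂ) (hω : ω ∈ Metric.sphere 0 ε) :
      ‖f ω * (a n * (ω ^ N n)⁻¹)‖ ≤ C * ‖a n * ((ε : ℂ) ^ N n)⁻¹‖ := by
    have hnorm : ‖a n * (ω ^ N n)⁻¹‖ = ‖a n * ((ε : ℂ) ^ N n)⁻¹‖ := by
      simp only [norm_mul, norm_inv, norm_pow, mem_sphere_zero_iff_norm.1 hω,
        Complex.norm_of_nonneg hε.le]
    rw [norm_mul, hnorm]
    exact mul_le_mul_of_nonneg_right (hC ω hω) (norm_nonneg _)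
  obtain ⟨hci, hsum⟩ := hasSum_circleIntegral_of_summable_norm hε.le (ha.mul_left C) hcont hle
  have hae : ∀ᵐ t : ℝ, ∑' n, f (circleMap 0 ε t) * (a n * (circleMap 0 ε t ^ N n)⁻¹) =
      f (circleMap 0 ε t) * rayIntegral (θ (circleMap 0 ε t)) (K (circleMap 0 ε t)) :=
    hθ.mono fun t ht => ((hK _ (mem_sphere_zero_iff_norm.1 (circleMap_mem_sphere 0 hε.le t))
      ht).2.mul_left _).tsum_eq
  refine ⟨fun ω hω hgood => (hK ω hω hgood).1, hci.congr_ae (ae_restrict_of_ae hae), ?_⟩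
  rw [← circleIntegral_congr_ae (g := fun ω => ∑' n, f ω * (a n * (ω ^ N n)⁻¹)) hae]
  refine hv.unique ((hsum.mul_left κ).congr_fun fun n => ?_)
  simp only [mul_left_comm (f _), circleIntegral.integral_const_mul]

theorem isCircleRayIntegral_qKernel (hD : IsRayDenominator x a b D) (hF : IsQFactorial x a b F)
    (hmom : ∀ c ∈ Complex.slitPlane, c * moment D c 0 = x * Real.log x / b) (hε : 0 < ε)
    (hf : ContinuousOn f (Metric.sphere 0 ε))
    (hθ : ∀ᵐ t : ℝ, IsGoodDirection (circleMap 0 ε t) (θ (circleMap 0 ε t)))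
    (hz : x ^ k * ‖z‖ < ε) {v : ℂ}
    (hv : HasSum (fun n => F (n + k) / F n * (cauchyPowerSeries f 0 ε).coeff (n + k) * z ^ n) v) :
    IsCircleRayIntegral f ε θ (qKernel F D x k z)
      (b / (2 * Real.log x * Real.pi * Complex.I)) v := by
  refine isCircleRayIntegral_of_hasSum hε hf hθ (fun ω hω hgood => hD.rayIntegral_qKernel hF
    (hgood.mul_exp_mem_slitPlane (norm_pos_iff.1 (hω ▸ hε))) (hω ▸ hz) hmom) ?_
    (hv.congr_fun fun n => ?_)
  · have hεz : x ^ k * ‖z‖ < ‖(ε : ℂ)‖ := by rwa [Complex.norm_of_nonneg hε.le]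
    refine (hD.rayIntegral_qKernel (θ := 0) hF ?_ hεz hmom).2.summable.norm
    simpa using hε
  · have hlog : (Real.log x : ℂ) ≠ 0 := by exact_mod_cast (Real.log_pos hF.one_lt).ne'
    have hb : (b : ℂ) ≠ 0 := by exact_mod_cast hF.pos.ne'
    rw [cauchyPowerSeries_coeff]
    field_simp

end CircleRayIntegral

section PQDerivative

variable {p q : ℝ}

/-- The `(p,q)`-number `p ^ (n - 1) + p ^ (n - 2) q + ⋯ + q ^ (n - 1)`, by which `D_{p,q}`
multiplies `z ^ n` while lowering its degree by one. -/
def pqNumber (p q : ℝ) (n : ℕ) : ℝ := ∑ i ∈ Finset.range n, p ^ i * q ^ (n - 1 - i)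

/-- The `(p,q)`-factorial, the product of the first `n` positive `(p,q)`-numbers. -/
def pqFactorial (p q : ℝ) (n : ℕ) : ℝ := ∏ i ∈ Finset.range n, pqNumber p q (i + 1)

lemma pqNumber_mul (p q : ℝ) (n : ℕ) : pqNumber p q n * (p - q) = p ^ n - q ^ n :=
  geom_sum₂_mul p q n

lemma pqNumber_zero_succ (q : ℝ) (n : ℕ) : pqNumber 0 q (n + 1) = q ^ n := by
  simp [pqNumber, Finset.sum_range_succ']

lemma pqNumber_succ (hp : p ≠ 0) (q : ℝ) (n : ℕ) :
    pqNumber p q (n + 1) = p ^ n * qNumber (q / p) (n + 1) := by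
  rw [pqNumber, qNumber, ← Finset.sum_range_reflect, Finset.mul_sum]
  refine Finset.sum_congr rfl fun i hi => ?_
  obtain ⟨m, rfl⟩ := Nat.exists_eq_add_of_le (Finset.mem_range_succ_iff.1 hi)
  rw [show i + m + 1 - 1 - i = m by lia, show i + m + 1 - 1 - m = i by lia, div_pow, pow_add]
  field_simp

lemma pqNumber_succ_pos (hp : 0 ≤ p) (hq : 0 < q) (n : ℕ) : 0 < pqNumber p q (n + 1) := by
  rw [pqNumber, Finset.sum_range_succ']
  have : 0 < p ^ 0 * q ^ (n + 1 - 1 - 0) := by rw [pow_zero, one_mul]; positivity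
  positivity

lemma pqFactorial_pos (hp : 0 ≤ p) (hq : 0 < q) (n : ℕ) : 0 < pqFactorial p q n :=
  Finset.prod_pos fun i _ => pqNumber_succ_pos hp hq i

lemma pqFactorial_succ (p q : ℝ) (n : ℕ) :
    pqFactorial p q (n + 1) = pqFactorial p q n * pqNumber p q (n + 1) :=
  Finset.prod_range_succ _ n

lemma pqFactorial_zero_left (q : ℝ) (n : ℕ) : pqFactorial 0 q n = q ^ (n * (n - 1) / 2) := by
  induction n with
  | zero => simp [pqFactorial]
  | succ n ih => rw [pqFactorial_succ, ih, pqNumber_zero_succ, Nat.triangle_succ, pow_add]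

lemma pqFactorial_eq (hp : p ≠ 0) (q : ℝ) (n : ℕ) :
    pqFactorial p q n = p ^ (n * (n - 1) / 2) * qFactorial (q / p) n := by
  induction n with
  | zero => simp [pqFactorial, qFactorial]
  | succ n ih =>
    rw [pqFactorial_succ, ih, pqNumber_succ hp, Nat.triangle_succ, pow_add, qFactorial, qFactorial,
      Finset.prod_range_succ]
    ring

lemma triangle_add (n k : ℕ) :
    (n + k) * (n + k - 1) / 2 = n * (n - 1) / 2 + k * n + k * (k - 1) / 2 := by
  induction k with
  | zero => simp
  | succ k ih =>
    rw [← add_assoc, Nat.triangle_succ, ih, Nat.triangle_succ]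
    ring

lemma pqFactorial_add_div (hp : p ≠ 0) (q : ℝ) (n k : ℕ) :
    pqFactorial p q (n + k) / pqFactorial p q n =
      p ^ (k * (k - 1) / 2) *
        ((p ^ k) ^ n * (qFactorial (q / p) (n + k) / qFactorial (q / p) n)) := by
  rw [pqFactorial_eq hp, pqFactorial_eq hp, triangle_add, pow_add, pow_add, pow_mul]
  field_simp

lemma pqDeriv_zero_eq_coeff_one {g : ℂ → ℂ} {a : ℕ → ℂ} {ρ : ℝ} (hρ : 0 < ρ)
    (hg : ∀ w : ℂ, ‖w‖ < ρ → HasSum (fun n => a n * w ^ n) (g w)) : pqDeriv p q g 0 = a 1 := by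
  have hseries : HasFPowerSeriesAt g (FormalMultilinearSeries.ofScalars ℂ a) 0 := by
    refine hasFPowerSeriesAt_iff.2 ?_
    filter_upwards [Metric.ball_mem_nhds (0 : ℂ) hρ] with w hw
    simpa only [FormalMultilinearSeries.coeff_ofScalars, smul_eq_mul, zero_add, mul_comm] using
      hg w (mem_ball_zero_iff.1 hw)
  rw [pqDeriv, if_pos rfl, hseries.deriv]
  simp [FormalMultilinearSeries.ofScalars]

lemma hasSum_pqDeriv (hp : 0 ≤ p) (hpq : p < q) {g : ℂ → ℂ} {a : ℕ → ℂ} {ρ : ℝ} (hρ : 0 < ρ)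
    (hg : ∀ w : ℂ, ‖w‖ < ρ → HasSum (fun n => a n * w ^ n) (g w)) {z : ℂ} (hz : q * ‖z‖ < ρ) :
    HasSum (fun n => pqNumber p q (n + 1) * a (n + 1) * z ^ n) (pqDeriv p q g z) := by
  rcases eq_or_ne z 0 with rfl | hz₀
  · rw [pqDeriv_zero_eq_coeff_one hρ hg]
    simpa [pqNumber] using hasSum_single
      (f := fun n => (pqNumber p q (n + 1) : ℂ) * a (n + 1) * (0 : ℂ) ^ n) 0
      fun n hn => by simp [hn]
  · have hqz : ‖(q : ℂ) * z‖ < ρ := by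
      rwa [norm_mul, Complex.norm_of_nonneg (hp.trans hpq.le)]
    have hpz : ‖(p : ℂ) * z‖ < ρ := by
      rw [norm_mul, Complex.norm_of_nonneg hp]
      exact (mul_le_mul_of_nonneg_right hpq.le (norm_nonneg z)).trans_lt hz
    have hne : (p : ℂ) - q ≠ 0 := by exact_mod_cast (sub_neg.2 hpq).ne
    have hdiff := (hasSum_nat_add_iff' 1).2 ((hg _ hpz).sub (hg _ hqz))
    simp only [Finset.sum_range_one, pow_zero, sub_self, sub_zero] at hdiff
    rw [pqDeriv, if_neg hz₀]
    refine (hdiff.div_const _).congr_fun fun n => ?_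
    have hnum : (pqNumber p q (n + 1) : ℂ) * (p - q) = p ^ (n + 1) - q ^ (n + 1) := by
      exact_mod_cast pqNumber_mul p q (n + 1)
    rw [← sub_mul, eq_div_iff (mul_ne_zero hne hz₀), mul_pow, mul_pow]
    linear_combination (a (n + 1) * z ^ (n + 1)) * hnum

lemma hasSum_iterate_pqDeriv (hp : 0 ≤ p) (hpq : p < q) {f : ℂ → ℂ} {a : ℕ → ℂ} {ε : ℝ}
    (hε : 0 < ε) (hf : ∀ w : ℂ, ‖w‖ < ε → HasSum (fun n => a n * w ^ n) (f w)) (k : ℕ) {z : ℂ}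
    (hz : q ^ k * ‖z‖ < ε) :
    HasSum (fun n => (pqFactorial p q (n + k) / pqFactorial p q n : ℝ) * a (n + k) * z ^ n)
      ((pqDeriv p q)^[k] f z) := by
  have hq : 0 < q := hp.trans_lt hpq
  have hne (n : ℕ) : pqFactorial p q n ≠ 0 := (pqFactorial_pos hp hq n).ne'
  induction k generalizing z with
  | zero => simpa [div_self (hne _)] using hf z (by simpa using hz)
  | succ k ih =>
    rw [Function.iterate_succ_apply']
    have hz' : q * ‖z‖ < ε / q ^ k := by
      rwa [lt_div_iff₀' (pow_pos hq k), ← mul_assoc, ← pow_succ]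
    refine (hasSum_pqDeriv hp hpq (div_pos hε (pow_pos hq k))
      (fun w hw => ih ((lt_div_iff₀' (pow_pos hq k)).1 hw)) hz').congr_fun fun n => ?_
    have hquot : pqFactorial p q (n + (k + 1)) / pqFactorial p q n =
        pqNumber p q (n + 1) * (pqFactorial p q (n + 1 + k) / pqFactorial p q (n + 1)) := by
      have hsucc := pqFactorial_succ p q n
      have := hne n
      have := hne (n + 1)
      rw [show n + (k + 1) = n + 1 + k by ring]
      field_simp
      rw [hsucc]
      ring
    rw [hquot, show n + (k + 1) = n + 1 + k by ring]
    push_cast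
    ring

lemma hasSum_cauchyPowerSeries {f : ℂ → ℂ} {ε : ℝ} (hε : 0 < ε)
    (hf : DiffContOnCl ℂ f (Metric.ball 0 ε)) {w : ℂ} (hw : ‖w‖ < ε) :
    HasSum (fun n => (cauchyPowerSeries f 0 ε).coeff n * w ^ n) (f w) := by
  lift ε to NNReal using hε.le
  have h := (hf.hasFPowerSeriesOnBall (NNReal.coe_pos.1 hε)).hasSum (y := w) (by simpa using hw)
  simpa only [FormalMultilinearSeries.apply_eq_pow_smul_coeff, smul_eq_mul, zero_add, mul_comm]
    using h

end PQDerivative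

section GrowthExponent

variable {q : ℝ}

lemma norm_qE_le_norm_qTheta_norm (hq : 1 < q) {z : ℂ} (hz : z ≠ 0) :
    ‖qE q z‖ ≤ ‖qTheta q ‖z‖‖ := by
  have hznorm : (‖z‖ : ℂ) ≠ 0 := by exact_mod_cast norm_ne_zero_iff.2 hz
  set u : ℤ → ℝ := fun n => ‖z‖ ^ n / q ^ (n * (n - 1) / 2) with hu
  have hu₀ (n : ℤ) : 0 ≤ u n := by have := one_pos.trans hq; positivity
  have hθ : qTheta q ‖z‖ = (∑' n, u n : ℝ) := by
    rw [qTheta, Complex.ofReal_tsum]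
    simp only [hu, Complex.ofReal_div, Complex.ofReal_zpow]
  have hsum : Summable u := by
    refine Complex.summable_ofReal.1 ?_
    simpa only [hu, Complex.ofReal_div, Complex.ofReal_zpow] using
      (hasSum_qTheta hq hznorm).summable
  rw [hθ, Complex.norm_of_nonneg (tsum_nonneg hu₀)]
  refine le_trans ?_ (tsum_comp_le_tsum_of_inj hsum hu₀ Nat.cast_injective)
  refine tsum_of_norm_bounded (hsum.comp_injective Nat.cast_injective).hasSum fun n => le_of_eq ?_
  simp only [hu, Function.comp_apply, ← natCast_triangle, zpow_natCast, norm_div, norm_pow,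
    Complex.norm_of_nonneg (one_pos.trans hq).le]

lemma periodic_norm_qTheta_exp (hq : 1 < q) :
    Function.Periodic (fun u : ℝ =>
      ‖qTheta q (Real.exp u)‖ * Real.exp (-(u ^ 2 / (2 * Real.log q) + u / 2))) (Real.log q) := by
  intro u
  have hq₀ : 0 < q := one_pos.trans hq
  have hlog : Real.log q ≠ 0 := (Real.log_pos hq).ne'
  have hexp : (Real.exp u : ℂ) ≠ 0 := by exact_mod_cast (Real.exp_pos u).ne'
  have hweight : -((u + Real.log q) ^ 2 / (2 * Real.log q) + (u + Real.log q) / 2) =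
      -(Real.log q + u) + -(u ^ 2 / (2 * Real.log q) + u / 2) := by
    field_simp
    ring
  beta_reduce
  rw [hweight, Real.exp_add (-_), Real.exp_neg, Real.exp_add, Real.exp_add, Real.exp_log hq₀,
    mul_comm (Real.exp u), Complex.ofReal_mul, qTheta_mul hq hexp, norm_mul, norm_mul,
    Complex.norm_of_nonneg hq₀.le, Complex.norm_of_nonneg (Real.exp_pos u).le]
  field_simp

lemma isGrowthExponent_half (hq : 1 < q) : IsGrowthExponent q (1 / 2) := by
  have hcont : Continuous fun u : ℝ =>
      ‖qTheta q (Real.exp u)‖ * Real.exp (-(u ^ 2 / (2 * Real.log q) + u / 2)) := by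
    have hexp (u : ℝ) : (Real.exp u : ℂ) ≠ 0 := by exact_mod_cast (Real.exp_pos u).ne'
    exact ((continuousOn_qTheta hq).comp_continuous (by fun_prop) hexp).norm.mul (by fun_prop)
  obtain ⟨K, hK⟩ := isCompact_Icc.exists_bound_of_continuousOn
    (hcont.continuousOn (s := Icc 0 (Real.log q)))
  refine ⟨max K 1, by positivity, fun z hz => ?_⟩
  have hz₀ : 0 < ‖z‖ := norm_pos_iff.2 hz
  obtain ⟨v, hv, hper⟩ :=
    (periodic_norm_qTheta_exp hq).exists_mem_Ico₀ (Real.log_pos hq) (Real.log ‖z‖)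
  have hbound := (Real.le_norm_self _).trans ((hK v (Ico_subset_Icc_self hv)).trans
    (le_max_left K 1))
  rw [← hper, Real.exp_log hz₀, Real.exp_neg, ← div_eq_mul_inv, div_le_iff₀ (Real.exp_pos _),
    Real.exp_add, ← mul_assoc] at hbound
  rw [Real.rpow_def_of_pos hz₀, mul_one_div]
  exact (norm_qE_le_norm_qTheta_norm hq hz).trans hbound

end GrowthExponent

section CauchyFormula

variable {p q ε : ℝ} {f : ℂ → ℂ} {θ : ℂ → ℝ} {z : ℂ} {k : ℕ}

lemma ae_circleMap_isGoodDirection (hε : 0 < ε)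
    (hθ : {ω : ℂ | ‖ω‖ = ε ∧ ¬ IsGoodDirection ω (θ ω)}.Finite) :
    ∀ᵐ t : ℝ, IsGoodDirection (circleMap 0 ε t) (θ (circleMap 0 ε t)) := by
  filter_upwards [(hθ.countable.preimage_circleMap 0 hε.ne').ae_notMem volume] with t ht
  by_contra hbad
  exact ht ⟨mem_sphere_zero_iff_norm.1 (circleMap_mem_sphere 0 hε.le t), hbad⟩

theorem isCircleRayIntegral_qE_div_qTheta (hq : 1 < q) (hε : 0 < ε)
    (hf : DiffContOnCl ℂ f (Metric.ball 0 ε))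
    (hθ : ∀ᵐ t : ℝ, IsGoodDirection (circleMap 0 ε t) (θ (circleMap 0 ε t)))
    (hz : q ^ k * ‖z‖ < ε) :
    IsCircleRayIntegral f ε θ (fun ω ζ => ζ ^ k * (qE q (z * ζ) / qTheta q (q * ω * ζ)))
      (q / (2 * Real.log q * Real.pi * Complex.I)) ((pqDeriv 0 q)^[k] f z) := by
  have hq₀ : 0 < q := one_pos.trans hq
  rw [qE_eq_genExp]
  refine isCircleRayIntegral_qKernel (isRayDenominator_qTheta hq) (isQFactorial_triangle hq)
    (fun c hc => ?_) hε (hf.continuousOn_ball.mono Metric.sphere_subset_closedBall) hθ hz ?_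
  · rw [mul_moment_zero_qTheta hq hc, mul_div_cancel_left₀ _ (by exact_mod_cast hq₀.ne')]
  · simpa only [pqFactorial_zero_left, Complex.ofReal_div] using
      hasSum_iterate_pqDeriv le_rfl hq₀ hε (fun w => hasSum_cauchyPowerSeries hε hf) k hz

theorem isCircleRayIntegral_qExp_div_qExp (hp : 0 < p) (hpq : p < q) (hε : 0 < ε)
    (hf : DiffContOnCl ℂ f (Metric.ball 0 ε))
    (hθ : ∀ᵐ t : ℝ, IsGoodDirection (circleMap 0 ε t) (θ (circleMap 0 ε t)))
    (hz : q ^ k * ‖z‖ < ε) :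
    IsCircleRayIntegral f ε θ
      (fun ω ζ => ζ ^ k * (qExp (q / p) (p ^ k * z * ζ) / qExp (q / p) (q / p * ω * ζ)))
      (p ^ (k * (k - 1) / 2) * (q / p - 1) / (2 * Real.log (q / p) * Real.pi * Complex.I))
      ((pqDeriv p q)^[k] f z) := by
  have hx : 1 < q / p := (one_lt_div hp).2 hpq
  have hpow : (p : ℂ) ^ (k * (k - 1) / 2) ≠ 0 := pow_ne_zero _ (by exact_mod_cast hp.ne')
  have hpz : (q / p) ^ k * ‖(p : ℂ) ^ k * z‖ < ε := by
    rwa [norm_mul, norm_pow, Complex.norm_of_nonneg hp.le, ← mul_assoc, ← mul_pow,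
      div_mul_cancel₀ _ hp.ne']
  have hseries := (hasSum_iterate_pqDeriv hp.le hpq hε
    (fun w => hasSum_cauchyPowerSeries hε hf) k hz).div_const ((p : ℂ) ^ (k * (k - 1) / 2))
  have h := (isCircleRayIntegral_qKernel (isRayDenominator_qExp hx) (isQFactorial_qFactorial hx)
    (fun c hc => mul_moment_zero_qExp hx hc) hε
    (hf.continuousOn_ball.mono Metric.sphere_subset_closedBall) hθ hpz
    (hseries.congr_fun fun n => ?_)).const_mul ((p : ℂ) ^ (k * (k - 1) / 2))
  · rw [mul_div_cancel₀ _ hpow, ← mul_div_assoc] at h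
    simp only [Complex.ofReal_sub, Complex.ofReal_one] at h
    rw [← Complex.ofReal_div]
    exact h
  · rw [pqFactorial_add_div hp.ne', mul_pow]
    push_cast
    field_simp

end CauchyFormula

end PQ

end

theorem corollary1_general (p q : ℝ) (hpq : p < q) (ε : ℝ) (hε : 0 < ε) (f : ℂ → ℂ)
    (hf : DiffContOnCl ℂ f (Metric.ball 0 ε)) (k : ℕ) (θ : ℂ → ℝ)
    (hθ : ∀ᵐ t : ℝ, PQ.IsGoodDirection (circleMap 0 ε t) (θ (circleMap 0 ε t))) :
    (p = 0 → 1 < q → PQ.IsGrowthExponent q (1 / 2) ∧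
      ∀ z : ℂ, q ^ k * ‖z‖ < ε → PQ.IsCircleRayIntegral f ε θ
        (fun ω ζ => ζ ^ k * (PQ.qE q (z * ζ) / PQ.qTheta q (q * ω * ζ)))
        (q / (2 * Real.log q * Real.pi * Complex.I)) ((PQ.pqDeriv p q)^[k] f z)) ∧
    (0 < p → ∀ z : ℂ, q ^ k * ‖z‖ < ε → PQ.IsCircleRayIntegral f ε θ
      (fun ω ζ => ζ ^ k * (PQ.qExp (q / p) (p ^ k * z * ζ) / PQ.qExp (q / p) (q / p * ω * ζ)))
      (p ^ (k * (k - 1) / 2) * (q / p - 1) / (2 * Real.log (q / p) * Real.pi * Complex.I))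
      ((PQ.pqDeriv p q)^[k] f z)) :=
  ⟨fun hp hq => ⟨PQ.isGrowthExponent_half hq, fun _ hz =>
    hp ▸ PQ.isCircleRayIntegral_qE_div_qTheta hq hε hf hθ hz⟩,
    fun hp _ hz => PQ.isCircleRayIntegral_qExp_div_qExp hp hpq hε hf hθ hz⟩

theorem corollary1 (p q : ℝ) (hp : 0 ≤ p) (hpq : p < q)
    (r ε : ℝ) (hε : 0 < ε) (hεr : ε < r)
    (f : ℂ → ℂ) (hf : DifferentiableOn ℂ f (Metric.ball 0 r)) (k : ℕ)
    (θ : ℂ → ℝ) (hθ : {ω : ℂ | ‖ω‖ = ε ∧ ¬ PQ.IsGoodDirection ω (θ ω)}.Finite) :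
    (p = 0 → 1 < q →
      (∃ α : ℝ, PQ.IsGrowthExponent q α) ∧
      ∀ α : ℝ, PQ.IsGrowthExponent q α →
      ∀ z : ℂ, ‖z‖ < (q ^ k)⁻¹ * ε * min 1 (q ^ ((1 : ℝ) / 2 - α)) →
        (∀ ω : ℂ, ‖ω‖ = ε → PQ.IsGoodDirection ω (θ ω) →
          PQ.RayIntegrable (θ ω)
            (fun ζ => ζ ^ k * (PQ.qE q (z * ζ) / PQ.qTheta q ((q : ℂ) * ω * ζ)))) ∧
        CircleIntegrable (fun ω => f ω * PQ.rayIntegral (θ ω)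
            (fun ζ => ζ ^ k * (PQ.qE q (z * ζ) / PQ.qTheta q ((q : ℂ) * ω * ζ)))) 0 ε ∧
        (PQ.pqDeriv p q)^[k] f z =
          (q : ℂ) / (2 * (Real.log q : ℂ) * (Real.pi : ℂ) * Complex.I) *
            ∮ ω in C(0, ε), f ω * PQ.rayIntegral (θ ω)
              (fun ζ => ζ ^ k * (PQ.qE q (z * ζ) / PQ.qTheta q ((q : ℂ) * ω * ζ)))) ∧
    (0 < p →
      ∀ z : ℂ, ‖z‖ < (q ^ k)⁻¹ * ε →
        (∀ ω : ℂ, ‖ω‖ = ε → PQ.IsGoodDirection ω (θ ω) →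
          PQ.RayIntegrable (θ ω)
            (fun ζ => ζ ^ k * (PQ.qExp (q / p) ((p : ℂ) ^ k * z * ζ) /
              PQ.qExp (q / p) ((q : ℂ) / (p : ℂ) * ω * ζ)))) ∧
        CircleIntegrable (fun ω => f ω * PQ.rayIntegral (θ ω)
            (fun ζ => ζ ^ k * (PQ.qExp (q / p) ((p : ℂ) ^ k * z * ζ) /
              PQ.qExp (q / p) ((q : ℂ) / (p : ℂ) * ω * ζ)))) 0 ε ∧
        (PQ.pqDeriv p q)^[k] f z =
          (p : ℂ) ^ (k * (k - 1) / 2) * ((q : ℂ) / (p : ℂ) - 1) /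
              (2 * (Real.log (q / p) : ℂ) * (Real.pi : ℂ) * Complex.I) *
            ∮ ω in C(0, ε), f ω * PQ.rayIntegral (θ ω)
              (fun ζ => ζ ^ k * (PQ.qExp (q / p) ((p : ℂ) ^ k * z * ζ) /
                PQ.qExp (q / p) ((q : ℂ) / (p : ℂ) * ω * ζ)))) := by
  have hq : 0 < q := hp.trans_lt hpq
  have hpow (z : ℂ) (hz : ‖z‖ < (q ^ k)⁻¹ * ε) : q ^ k * ‖z‖ < ε :=
    (lt_inv_mul_iff₀ (pow_pos hq k)).1 hz
  obtain ⟨hzero, hpos⟩ := corollary1_general p q hpq ε hε f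
    (hf.diffContOnCl_ball (Metric.closedBall_subset_ball hεr)) k θ
    (PQ.ae_circleMap_isGoodDirection hε hθ)
  exact ⟨fun hp₀ hq₁ => ⟨⟨_, (hzero hp₀ hq₁).1⟩, fun α _ z hz => (hzero hp₀ hq₁).2 z (hpow z
    (hz.trans_le (mul_le_of_le_one_right (by positivity) (min_le_left _ _))))⟩,
    fun hp₀ z hz => hpos hp₀ z (hpow z hz)⟩
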